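/- Let $d_1,d_2\ge 1$ and let $\mathbb P^{N_{d_i}}$ be the projective space of plane curves of degree $d_i$ over $\mathbb C$. Let $\mathcal X=\mathcal X_1\cup\mathcal X_2\subset\mathbb P^2\times\mathbb P^{N_{d_1}}\times\mathbb P^{N_{d_2}}$, where $\mathcal X_i$ is the universal curve $\sum_{|\alpha|=d_i}a^{(i)}_\alpha Z^\alpha=0$, $[Z]\in\mathbb P^2$, $[a^{(i)}]\in\mathbb P^{N_{d_i}}$. Let $\overline{J_2^v}(\mathbb P^2\times\mathbb P^{N_{d_1}}\times\mathbb P^{N_{d_2}})$ be the space of logarithmic $2$-jets of the log manifold $(\mathbb P^2\times\mathbb P^{N_{d_1}}\times\mathbb P^{N_{d_2}},\mathcal X)$ which are tangent to the fibres of the projection to $\mathbb P^{N_{d_1}}\times\mathbb P^{N_{d_2}}$, and let $p_2$ be its projection to $\mathbb P^2\times\mathbb P^{N_{d_1}}\times\mathbb P^{N_{d_2}}$. Let $U\subset\mathbb P^{N_{d_1}+1}\times\mathbb P^{N_{d_2}+1}$ be the set of all $([a^{(1)}:A_1],[a^{(2)}:A_2])$ with $A_i\neq0$ and $a^{(i)}\neq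 0$ for $i=1,2$, and let $\mathcal Y\subset\mathbb P^4\times U$ be defined by $$A_1Z_3^{d_1}+\sum_{|\alpha|=d_1}a^{(1)}_\alpha Z^\alpha=0,\qquad A_2Z_4^{d_2}+\sum_{|\alpha|=d_2}a^{(2)}_\alpha Z^\alpha=0$$ (with $Z^\alpha=Z_0^{\alpha_0}Z_1^{\alpha_1}Z_2^{\alpha_2}$), with the divisor $H=(Z_3Z_4=0)$. The projection $(\mathcal Y,H)\to(\mathbb P^2\times\mathbb P^{N_{d_1}}\times\mathbb P^{N_{d_2}},\mathcal X)$ induces a map $\pi_2$ from the space $\overline{J_2^v}(\mathcal Y)$ of vertical logarithmic $2$-jets of $(\mathcal Y,H)$ to $\overline{J_2^v}(\mathbb P^2\times\mathbb P^{N_{d_1}}\times\mathbb P^{N_{d_2}})$. Let $\Sigma\subset\overline{J_2^v}(\mathcal Y)$ be the closure of the set of jets over $Z_0\ne0$ with $\det(\xi^{(j)}_i)_{1\le i,j\le 2}=0$, where $\xi_i^{(j)}$ is the $j$-th derivative along the jet of the affine coordinate $z_i=Z_i/Z_0$. Then $$T_{\overline{J_2^v}(\mathbb P^2\times\mathbb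 P^{N_{d_1}}\times\mathbb P^{N_{d_2}})}\otimes\mathcal O_{\mathbb P^2}(7)\otimes\mathcal O_{\mathbb P^{N_{d_1}}}(*)\otimes\mathcal O_{\mathbb P^{N_{d_2}}}(*)$$ is generated by its global sections on $\overline{J_2^v}(\mathbb P^2\times\mathbb P^{N_{d_1}}\times\mathbb P^{N_{d_2}})\setminus(\pi_2(\Sigma)\cup p_2^{-1}(\mathcal X))$. That is, there are integers $m_1,m_2\ge0$ (depending only on $d_1,d_2$) such that at every point of this set the global algebraic (in particular holomorphic) sections of $T\otimes\mathcal O_{\mathbb P^2}(7)\otimes\mathcal O_{\mathbb P^{N_{d_1}}}(m_1)\otimes\mathcal O_{\mathbb P^{N_{d_2}}}(m_2)$ span the fibre. (Over $p_2^{-1}(\mathcal X)$, where the jet space may be singular, $T$ denotes the tangent sheaf.) -/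

import Mathlib

open MvPolynomial

noncomputable section

namespace LogJets

/-! ### Plane curves and 2-jets in homogeneous coordinates

The index `c : Fin 2` numbers the two components, `d c` is the degree of the component `c`. -/

/-- Exponents `α = (α₀, α₁, α₂)` with `|α| = d`, i.e. the coordinates on `ℂ ^ (N_d + 1)`. -/
abbrev Mon (d : ℕ) : Type :=
  {α : Fin 3 → ℕ // α ∈ Finset.piAntidiag (Finset.univ : Finset (Fin 3)) d}

/-- The form `∑_{|α| = d} a_α Z ^ α`. -/
def form {d : ℕ} (a : Mon d → ℂ) : MvPolynomial (Fin 3) ℂ :=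
  ∑ α : Mon d, C (a α) * ∏ i : Fin 3, X i ^ α.1 i

/-- A 2-jet of a curve `t ↦ Z(t)` in `ℂ³`: `z k i` is the `k`-th derivative of `Z_i` at `t = 0`. -/
abbrev Jet : Type := Fin 3 → Fin 3 → ℂ

/-- `F(Z(t))` at `t = 0`. -/
def jetVal (F : MvPolynomial (Fin 3) ℂ) (z : Jet) : ℂ := eval (z 0) F

/-- `d/dt F(Z(t))` at `t = 0`. -/
def jetDer (F : MvPolynomial (Fin 3) ℂ) (z : Jet) : ℂ :=
  ∑ j, eval (z 0) (pderiv j F) * z 1 j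

/-- `d²/dt² F(Z(t))` at `t = 0`. -/
def jetDer2 (F : MvPolynomial (Fin 3) ℂ) (z : Jet) : ℂ :=
  (∑ j, eval (z 0) (pderiv j F) * z 2 j) +
    ∑ j, ∑ k, eval (z 0) (pderiv k (pderiv j F)) * z 1 j * z 1 k

/-- The 2-jet of `l(t) Z(t)`, for a 2-jet `l = (l(0), l'(0), l''(0))` of a function. -/
def scaleJet (l : Fin 3 → ℂ) (z : Jet) : Jet :=
  ![l 0 • z 0, l 0 • z 1 + l 1 • z 0, l 0 • z 2 + (2 * l 1) • z 1 + l 2 • z 0]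

/-- `((log l)'(0), (log l)''(0))`. -/
def logJet (l : Fin 3 → ℂ) : Fin 2 → ℂ := ![l 1 / l 0, l 2 / l 0 - (l 1 / l 0) ^ 2]

/-- The 2-jet of `l m`. -/
def mulJet (l m : Fin 3 → ℂ) : Fin 3 → ℂ :=
  ![l 0 * m 0, l 0 * m 1 + l 1 * m 0, l 0 * m 2 + 2 * l 1 * m 1 + l 2 * m 0]

/-- The 2-jet of `1 / l`. -/
def invJet (l : Fin 3 → ℂ) : Fin 3 → ℂ :=
  ![1 / l 0, - l 1 / l 0 ^ 2, 2 * l 1 ^ 2 / l 0 ^ 3 - l 2 / l 0 ^ 2]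

/-- The constant jet `1`. -/
def oneJet : Fin 3 → ℂ := ![1, 0, 0]

theorem scaleJet_mul (l m : Fin 3 → ℂ) (z : Jet) :
    scaleJet (mulJet l m) z = scaleJet l (scaleJet m z) := by
  funext k i
  fin_cases k <;> simp [scaleJet, mulJet] <;> ring

theorem scaleJet_one (z : Jet) : scaleJet oneJet z = z := by
  funext k i
  fin_cases k <;> simp [scaleJet, oneJet]

theorem logJet_mul (l m : Fin 3 → ℂ) (hl : l 0 ≠ 0) (hm : m 0 ≠ 0) :
    logJet (mulJet l m) = logJet l + logJet m := by
  funext k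
  fin_cases k <;> simp [logJet, mulJet] <;> field_simp <;> ring

theorem logJet_one : logJet oneJet = 0 := by
  funext k
  fin_cases k <;> simp [logJet, oneJet]

theorem invJet_ne (l : Fin 3 → ℂ) (hl : l 0 ≠ 0) : invJet l 0 ≠ 0 := by
  simp [invJet, hl]

theorem mulJet_ne (l m : Fin 3 → ℂ) (hl : l 0 ≠ 0) (hm : m 0 ≠ 0) : mulJet l m 0 ≠ 0 := by
  simp [mulJet, hl, hm]

theorem invJet_mul (l : Fin 3 → ℂ) (hl : l 0 ≠ 0) : mulJet (invJet l) l = oneJet := by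
  funext k
  fin_cases k <;> simp [invJet, mulJet, oneJet] <;> field_simp <;> ring

/-! ### The space of vertical logarithmic 2-jets of `(ℙ² × ℙ^{N_{d₁}} × ℙ^{N_{d₂}}, 𝒳)` -/

/-- `ℙ²`. -/
abbrev Plane : Type := Projectivization ℂ (Fin 3 → ℂ)

/-- `ℙ² × ℙ^{N_{d₁}} × ℙ^{N_{d₂}}`. -/
abbrev Base (d : Fin 2 → ℕ) : Type :=
  Plane × ((c : Fin 2) → Projectivization ℂ (Mon (d c) → ℂ))

/-- The universal curve `𝒳_c`, the zero locus of `∑ a⁽ᶜ⁾_α Z ^ α`. -/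
def universalCurve (d : Fin 2 → ℕ) (c : Fin 2) : Set (Base d) :=
  {x | ∃ (z : Fin 3 → ℂ) (hz : z ≠ 0) (a : Mon (d c) → ℂ) (ha : a ≠ 0),
    x.1 = Projectivization.mk ℂ z hz ∧ x.2 c = Projectivization.mk ℂ a ha ∧ eval z (form a) = 0}

/-- `𝒳 = 𝒳₁ ∪ 𝒳₂`. -/
def universalFamily (d : Fin 2 → ℕ) : Set (Base d) := universalCurve d 0 ∪ universalCurve d 1

/-- Coordinates `(z, a, η)` of a vertical logarithmic 2-jet: `z` is the 2-jet of a lift `Z(t)` of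
the curve to `ℂ³ \ 0`, `a c` are the (constant) coefficients of the component `c`, and
`η c = ((log s_c)', (log s_c)'')` are the logarithmic coordinates of the jet along `𝒳_c`, where
`s_c = ∑ a⁽ᶜ⁾_α Z ^ α`. -/
abbrev Amb (d : Fin 2 → ℕ) : Type :=
  Jet × ((c : Fin 2) → Mon (d c) → ℂ) × (Fin 2 → Fin 2 → ℂ)

/-- `s' = s (log s)'`. -/
def eqOne (d : Fin 2 → ℕ) (c : Fin 2) (p : Amb d) : ℂ :=
  jetDer (form (p.2.1 c)) p.1 - jetVal (form (p.2.1 c)) p.1 * p.2.2 c 0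

/-- `s'' = s ((log s)'' + ((log s)')²)`. -/
def eqTwo (d : Fin 2 → ℕ) (c : Fin 2) (p : Amb d) : ℂ :=
  jetDer2 (form (p.2.1 c)) p.1 -
    jetVal (form (p.2.1 c)) p.1 * (p.2.2 c 1 + p.2.2 c 0 ^ 2)

/-- The vertical logarithmic 2-jets, in homogeneous coordinates. -/
def cone (d : Fin 2 → ℕ) : Set (Amb d) :=
  {p | p.1 0 ≠ 0 ∧ (∀ c, p.2.1 c ≠ 0) ∧ ∀ c, eqOne d c p = 0 ∧ eqTwo d c p = 0}

/-- Change of homogeneous coordinates: `Z(t)` becomes `l(t) Z(t)` and `a c` becomes `μ c • a c`, so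
that `log s_c` becomes `log s_c + d_c log l + const`. -/
def act (d : Fin 2 → ℕ) (l : Fin 3 → ℂ) (μ : Fin 2 → ℂ) (p : Amb d) : Amb d :=
  (scaleJet l p.1, fun c => μ c • p.2.1 c, fun c => p.2.2 c + (d c : ℂ) • logJet l)

theorem act_act (d : Fin 2 → ℕ) (l m : Fin 3 → ℂ) (μ ν : Fin 2 → ℂ) (hl : l 0 ≠ 0) (hm : m 0 ≠ 0)
    (p : Amb d) : act d l μ (act d m ν p) = act d (mulJet l m) (μ * ν) p := by
  simp only [act, scaleJet_mul, logJet_mul l m hl hm, Pi.mul_apply, smul_smul, Prod.mk.injEq,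
    true_and]
  funext c
  simp only [smul_add]
  abel

theorem act_one (d : Fin 2 → ℕ) (p : Amb d) : act d oneJet 1 p = p := by
  simp [act, scaleJet_one, logJet_one]

/-- Two systems of homogeneous coordinates represent the same jet. -/
instance jetSetoid (d : Fin 2 → ℕ) : Setoid (cone d) where
  r p q := ∃ l : Fin 3 → ℂ, l 0 ≠ 0 ∧ ∃ μ : Fin 2 → ℂ, (∀ c, μ c ≠ 0) ∧ q.1 = act d l μ p.1
  iseqv := by
    refine ⟨fun p => ⟨oneJet, by simp [oneJet], 1, by simp, (act_one d p.1).symm⟩, ?_, ?_⟩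
    · rintro p q ⟨l, hl, μ, hμ, h⟩
      refine ⟨invJet l, invJet_ne l hl, μ⁻¹, by simpa using hμ, ?_⟩
      have h1 : μ⁻¹ * μ = 1 := by funext c; simp [hμ c]
      rw [h, act_act d _ _ _ _ (invJet_ne l hl) hl, invJet_mul l hl, h1, act_one]
    · rintro p q r ⟨l, hl, μ, hμ, h⟩ ⟨m, hm, ν, hν, h'⟩
      refine ⟨mulJet m l, mulJet_ne m l hm hl, ν * μ, fun c => mul_ne_zero (hν c) (hμ c), ?_⟩
      rw [h', h, act_act d _ _ _ _ hm hl]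

/-- The space of vertical logarithmic 2-jets `J̄₂ᵛ(ℙ² × ℙ^{N_{d₁}} × ℙ^{N_{d₂}})` along `𝒳`. -/
abbrev LogJetSpace (d : Fin 2 → ℕ) : Type := Quotient (jetSetoid d)

/-- The projection `p₂` to `ℙ² × ℙ^{N_{d₁}} × ℙ^{N_{d₂}}`. -/
def pTwo (d : Fin 2 → ℕ) : LogJetSpace d → Base d :=
  Quotient.lift
    (fun p => (Projectivization.mk ℂ (p.1.1 0) p.2.1,
      fun c => Projectivization.mk ℂ (p.1.2.1 c) (p.2.2.1 c))) (by
    rintro p q ⟨l, hl, μ, hμ, h⟩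
    refine Prod.ext ?_ (funext fun c => ?_)
    · refine ((Projectivization.mk_eq_mk_iff' ℂ _ _ q.2.1 p.2.1).2 ⟨l 0, ?_⟩).symm
      rw [h]; simp [act, scaleJet]
    · refine ((Projectivization.mk_eq_mk_iff' ℂ _ _ (q.2.2.1 c) (p.2.2.1 c)).2 ⟨μ c, ?_⟩).symm
      rw [h]; simp [act])

/-! ### The covering `𝒴`, its logarithmic jets and the exceptional set `Σ`

`𝒴 ⊂ ℙ⁴ × U` is given by `A_c Z_{3+c} ^ {d_c} + ∑ a⁽ᶜ⁾_α Z ^ α = 0` (`c = 0, 1`), where `A_c ≠ 0`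
and `a⁽ᶜ⁾ ≠ 0`; its divisor is `H = (Z₃ Z₄ = 0)`. -/

/-- Coordinates `(z, y, ζ, a, A)` of a vertical logarithmic 2-jet of `(𝒴, H)`: `z` is the 2-jet of
`(Z₀, Z₁, Z₂)`, `y c` is the value of `Z_{3+c}` and `ζ c` are the first two derivatives of
`log Z_{3+c}`. -/
abbrev AmbY (d : Fin 2 → ℕ) : Type :=
  Jet × (Fin 2 → ℂ) × (Fin 2 → Fin 2 → ℂ) × ((c : Fin 2) → Mon (d c) → ℂ) × (Fin 2 → ℂ)

/-- The vertical logarithmic 2-jets of `(𝒴, H)`, in homogeneous coordinates: the equations say that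
`A_c Z_{3+c} ^ {d_c} + ∑ a⁽ᶜ⁾_α Z ^ α` vanishes to second order along the jet. -/
def coneY (d : Fin 2 → ℕ) : Set (AmbY d) :=
  {q | ¬ (q.1 0 = 0 ∧ q.2.1 = 0) ∧ (∀ c, q.2.2.2.1 c ≠ 0) ∧ (∀ c, q.2.2.2.2 c ≠ 0) ∧
    ∀ c,
      q.2.2.2.2 c * q.2.1 c ^ d c + jetVal (form (q.2.2.2.1 c)) q.1 = 0 ∧
      q.2.2.2.2 c * q.2.1 c ^ d c * (d c * q.2.2.1 c 0) + jetDer (form (q.2.2.2.1 c)) q.1 = 0 ∧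
      q.2.2.2.2 c * q.2.1 c ^ d c * (d c * q.2.2.1 c 1 + (d c * q.2.2.1 c 0) ^ 2) +
        jetDer2 (form (q.2.2.2.1 c)) q.1 = 0}

/-- Change of homogeneous coordinates on `ℙ⁴` (along the jet) and on the parameter spaces. -/
def actY (d : Fin 2 → ℕ) (l : Fin 3 → ℂ) (μ : Fin 2 → ℂ) (q : AmbY d) : AmbY d :=
  (scaleJet l q.1, l 0 • q.2.1, fun c => q.2.2.1 c + logJet l, fun c => μ c • q.2.2.2.1 c,
    μ * q.2.2.2.2)

theorem actY_actY (d : Fin 2 → ℕ) (l m : Fin 3 → ℂ) (μ ν : Fin 2 → ℂ) (hl : l 0 ≠ 0)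
    (hm : m 0 ≠ 0) (q : AmbY d) : actY d l μ (actY d m ν q) = actY d (mulJet l m) (μ * ν) q := by
  have h0 : mulJet l m 0 = l 0 * m 0 := by simp [mulJet]
  simp only [actY, scaleJet_mul, logJet_mul l m hl hm, Pi.mul_apply, smul_smul, Prod.mk.injEq,
    true_and, h0, mul_assoc, and_true]
  funext c
  abel

theorem actY_one (d : Fin 2 → ℕ) (q : AmbY d) : actY d oneJet 1 q = q := by
  have h0 : oneJet 0 = 1 := by simp [oneJet]
  simp [actY, scaleJet_one, logJet_one, h0]

/-- Two systems of homogeneous coordinates represent the same jet. -/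
instance jetSetoidY (d : Fin 2 → ℕ) : Setoid (coneY d) where
  r p q := ∃ l : Fin 3 → ℂ, l 0 ≠ 0 ∧ ∃ μ : Fin 2 → ℂ, (∀ c, μ c ≠ 0) ∧ q.1 = actY d l μ p.1
  iseqv := by
    refine ⟨fun p => ⟨oneJet, by simp [oneJet], 1, by simp, (actY_one d p.1).symm⟩, ?_, ?_⟩
    · rintro p q ⟨l, hl, μ, hμ, h⟩
      refine ⟨invJet l, invJet_ne l hl, μ⁻¹, by simpa using hμ, ?_⟩
      have h1 : μ⁻¹ * μ = 1 := by funext c; simp [hμ c]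
      rw [h, actY_actY d _ _ _ _ (invJet_ne l hl) hl, invJet_mul l hl, h1, actY_one]
    · rintro p q r ⟨l, hl, μ, hμ, h⟩ ⟨m, hm, ν, hν, h'⟩
      refine ⟨mulJet m l, mulJet_ne m l hm hl, ν * μ, fun c => mul_ne_zero (hν c) (hμ c), ?_⟩
      rw [h', h, actY_actY d _ _ _ _ hm hl]

/-- The space `J̄₂ᵛ(𝒴)`, with its quotient topology. -/
abbrev LogJetSpaceY (d : Fin 2 → ℕ) : Type := Quotient (jetSetoidY d)

theorem eval_zero_form {d : ℕ} (hd : 1 ≤ d) (a : Mon d → ℂ) : eval 0 (form a) = 0 := by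
  simp only [form, map_sum, map_mul, eval_C, map_prod, map_pow, eval_X, Pi.zero_apply]
  refine Finset.sum_eq_zero fun α _ => ?_
  have hα : ∑ i, α.1 i = d := (Finset.mem_piAntidiag.1 α.2).1
  obtain ⟨i, hi⟩ : ∃ i, α.1 i ≠ 0 := by
    by_contra! h
    simp [h] at hα
    omega
  rw [Finset.prod_eq_zero (Finset.mem_univ i) (zero_pow hi), mul_zero]

/-- The map on coordinates induced by the projection `𝒴 → ℙ² × ℙ^{N_{d₁}} × ℙ^{N_{d₂}}`; as
`s_c = - A_c Z_{3+c} ^ {d_c}`, the derivatives of `log s_c` are `d_c` times those of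
`log Z_{3+c}`. -/
def piAmb (d : Fin 2 → ℕ) (q : AmbY d) : Amb d :=
  (q.1, q.2.2.2.1, fun c => (d c : ℂ) • q.2.2.1 c)

theorem piAmb_mem (d : Fin 2 → ℕ) (hd : ∀ c, 1 ≤ d c) {q : AmbY d} (hq : q ∈ coneY d) :
    piAmb d q ∈ cone d := by
  obtain ⟨h0, ha, hA, h⟩ := hq
  refine ⟨fun hz => h0 ⟨hz, ?_⟩, ha, fun c => ?_⟩
  · funext c
    have h1 := (h c).1
    have hz' : q.1 0 = 0 := hz
    rw [jetVal, hz', eval_zero_form (hd c), add_zero] at h1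
    have h2 := (mul_eq_zero.1 h1).resolve_left (hA c)
    exact pow_eq_zero_iff (by have := hd c; omega) |>.1 h2
  · obtain ⟨h1, h2, h3⟩ := h c
    constructor
    · simp only [eqOne, piAmb, Pi.smul_apply, smul_eq_mul]
      linear_combination h2 - (d c * q.2.2.1 c 0) * h1
    · simp only [eqTwo, piAmb, Pi.smul_apply, smul_eq_mul]
      linear_combination h3 - (d c * q.2.2.1 c 1 + (d c * q.2.2.1 c 0) ^ 2) * h1

/-- The induced map `π₂ : J̄₂ᵛ(𝒴) → J̄₂ᵛ(ℙ² × ℙ^{N_{d₁}} × ℙ^{N_{d₂}})`. -/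
def piTwo (d : Fin 2 → ℕ) (hd : ∀ c, 1 ≤ d c) : LogJetSpaceY d → LogJetSpace d :=
  Quotient.map (fun q => ⟨piAmb d q.1, piAmb_mem d hd q.2⟩) (by
    rintro p q ⟨l, hl, μ, hμ, h⟩
    refine ⟨l, hl, μ, hμ, ?_⟩
    simp [h, piAmb, actY, act])

/-- `Σ₀ = {det (ξ_i⁽ʲ⁾)_{1 ≤ i, j ≤ 2} = 0}` over `Z₀ ≠ 0`, where `ξ_i⁽ʲ⁾` are the derivatives of the
affine coordinates `z_i = Z_i / Z₀`. -/
def sigmaZero (d : Fin 2 → ℕ) : Set (LogJetSpaceY d) :=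
  {y | ∃ q : coneY d, y = Quotient.mk (jetSetoidY d) q ∧
    q.1.1 0 0 = 1 ∧ q.1.1 1 0 = 0 ∧ q.1.1 2 0 = 0 ∧
    q.1.1 1 1 * q.1.1 2 2 - q.1.1 2 1 * q.1.1 1 2 = 0}

/-- `Σ`, the closure of `Σ₀` in `J̄₂ᵛ(𝒴)`. -/
def sigma (d : Fin 2 → ℕ) : Set (LogJetSpaceY d) := closure (sigmaZero d)

/-! ### Affine charts and sections of `T ⊗ 𝒪_{ℙ²}(e) ⊗ 𝒪_{ℙ^{N_{d₁}}}(m₁) ⊗ 𝒪_{ℙ^{N_{d₂}}}(m₂)` -/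

/-- A chart `(i, γ)`: the open set `Z_i ≠ 0`, `a⁽ᶜ⁾_{γ c} ≠ 0` (`c = 0, 1`). -/
abbrev Chart (d : Fin 2 → ℕ) : Type := Fin 3 × ((c : Fin 2) → Mon (d c))

/-- The chart `(i, γ)` as a closed algebraic subset of an affine space: the jets whose coordinates
are normalized by `Z_i(t) ≡ 1` and `a⁽ᶜ⁾_{γ c} = 1`. -/
def slice (d : Fin 2 → ℕ) (χ : Chart d) : Set (Amb d) :=
  {p | p ∈ cone d ∧ p.1 0 χ.1 = 1 ∧ p.1 1 χ.1 = 0 ∧ p.1 2 χ.1 = 0 ∧ ∀ c, p.2.1 c (χ.2 c) = 1}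

/-- The homogeneous coordinates of the points of the chart. -/
def domain (d : Fin 2 → ℕ) (χ : Chart d) : Set (Amb d) :=
  {p | p.1 0 χ.1 ≠ 0 ∧ ∀ c, p.2.1 c (χ.2 c) ≠ 0}

/-- Normalization of homogeneous coordinates in the chart `χ`; restricted to another chart it is the
change of charts. -/
def normalize (d : Fin 2 → ℕ) (χ : Chart d) (p : Amb d) : Amb d :=
  act d (invJet fun k => p.1 k χ.1) (fun c => (p.2.1 c (χ.2 c))⁻¹) p

/-- The tangent space of the chart `χ` at one of its points `p`: the kernel of the differentials of
the defining equations. -/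
def tangentSpace (d : Fin 2 → ℕ) (χ : Chart d) (p : Amb d) : Set (Amb d) :=
  {v | (∀ k, v.1 k χ.1 = 0) ∧ (∀ c, v.2.1 c (χ.2 c) = 0) ∧
    ∀ c, fderiv ℂ (eqOne d c) p v = 0 ∧ fderiv ℂ (eqTwo d c) p v = 0}

/-- The polynomial functions on a vector space: the algebra generated by the linear forms. -/
def polyFun (E : Type*) [AddCommGroup E] [Module ℂ E] : Subalgebra ℂ (E → ℂ) :=
  Algebra.adjoin ℂ (Set.range fun φ : Module.Dual ℂ E => (φ : E → ℂ))

/-- A global (algebraic, in particular holomorphic) section of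
`T ⊗ 𝒪_{ℙ²}(e) ⊗ 𝒪_{ℙ^{N_{d₁}}}(m₁) ⊗ 𝒪_{ℙ^{N_{d₂}}}(m₂)` on `J̄₂ᵛ`, given in every chart `χ = (i, γ)`
by a vector field (its coefficient with respect to the generator
`Z_i ^ e · ∏_c (a⁽ᶜ⁾_{γ c}) ^ {m_c}` of the line bundle). -/
structure TwistedVectorField (d : Fin 2 → ℕ) (e : ℕ) (m : Fin 2 → ℕ) where
  /-- The local expressions. -/
  toFun : Chart d → Amb d → Amb d
  /-- Their components are regular functions on the chart. -/
  regular : ∀ χ, ∀ φ : Module.Dual ℂ (Amb d), ∃ P ∈ polyFun (Amb d),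
    ∀ p ∈ slice d χ, φ (toFun χ p) = P p
  /-- They are tangent to the chart. -/
  tangent : ∀ χ, ∀ p ∈ slice d χ, toFun χ p ∈ tangentSpace d χ p
  /-- They are compatible with the changes of charts. -/
  compat : ∀ χ χ', ∀ p ∈ slice d χ, p ∈ domain d χ' →
    fderiv ℂ (normalize d χ') p (toFun χ p) =
      (p.1 0 χ'.1 ^ e * ∏ c, p.2.1 c (χ'.2 c) ^ m c) • toFun χ' (normalize d χ' p)

/-- The twisted tangent bundle is generated by its global sections at the point `x`: in each chart
around `x`, every tangent vector at `x` is the value of a global section. -/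
def GeneratedAt (d : Fin 2 → ℕ) (e : ℕ) (m : Fin 2 → ℕ) (x : LogJetSpace d) : Prop :=
  ∀ (χ : Chart d) (p : Amb d) (hp : p ∈ slice d χ), Quotient.mk (jetSetoid d) ⟨p, hp.1⟩ = x →
    ∀ v ∈ tangentSpace d χ p, ∃ V : TwistedVectorField d e m, V.toFun χ p = v

end LogJets

end

/-!
A section of the twisted tangent bundle is the same as a polynomial vector field on the space of
homogeneous coordinates that is tangent to the cone of logarithmic jets and has the corresponding
weight for the changes of coordinates; the weight can be raised by multiplying by a power of `Z_i`
and of the coefficients, hence it suffices to find enough vector fields of weight at most `4` in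
`ℙ²`.

* A linear vector field on `ℂ³` lifts to the cone, with weight `0`, if the curves move along with
  it. Where the Wronskian `det (Z, Z', Z'')` does not vanish, a matrix can send `Z`, `Z'`, `Z''`
  to any three vectors, so these lifts span all the directions of the jet of `Z`.
* A vertical vector field moves `s_c` by a form `F`, and the logarithmic derivatives of `s_c` by
  those of `F / s_c`; it is regular along `𝒳` only if the 2-jet of `F` is divisible by that of
  `s_c`. This holds for `s_c` itself, for its first two polars at `Z` multiplied by as many minors
  `Z_k X_j - Z_j X_k` (by Euler's relation the values of the polars are multiples of `s_c`), and
  for every form vanishing to order three at `Z`. If `s_c(Z) ≠ 0`, these forms span all forms of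
  degree `d_c`; their weights are `0`, `2`, `4` and `3`.

A jet outside `𝒳` with vanishing Wronskian lifts to `𝒴` with `Z₃ = Z₄ = 1`. The lift lies in `Σ`
even if `Z₀ = 0`: adding a multiple of another coordinate to `Z₀` makes `Z₀` non-zero and keeps the
Wronskian zero.
-/

noncomputable section

namespace LogJets

/-! ### Derivations and forms vanishing at a point -/

section Forms

variable {σ K : Type*}

/-- The `2 × 2` minors of the vector `u` and the vector of variables: linear forms that vanish
at `u`. -/
def minorForm [CommRing K] (u : σ → K) (k j : σ) : MvPolynomial σ K := u k • X j - u j • X k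

theorem isHomogeneous_minorForm [CommRing K] (u : σ → K) (k j : σ) :
    (minorForm u k j).IsHomogeneous 1 :=
  (homogeneousSubmodule σ K 1).sub_mem
    ((homogeneousSubmodule σ K 1).smul_mem _ (isHomogeneous_X K j))
    ((homogeneousSubmodule σ K 1).smul_mem _ (isHomogeneous_X K k))

theorem minorForm_smul [CommRing K] (r : K) (u : σ → K) (k j : σ) :
    minorForm (r • u) k j = r • minorForm u k j := by
  simp only [minorForm, Pi.smul_apply, smul_sub, smul_assoc]

theorem eq_zero_of_isHomogeneous_zero_of_eval_eq_zero [CommSemiring K] {F : MvPolynomial σ K}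
    (hF : F.IsHomogeneous 0) {u : σ → K} (h : eval u F = 0) : F = 0 := by
  rw [totalDegree_eq_zero_iff_eq_C.1 ((totalDegree_zero_iff_isHomogeneous σ).2 hF)] at h ⊢
  rw [eval_C] at h
  rw [h, C_0]

/-- The polarization of forms with respect to the vector `u`, i.e. the derivative in the constant
direction `u`. -/
def polar [CommSemiring K] (u : σ → K) : Derivation K (MvPolynomial σ K) (MvPolynomial σ K) :=
  mkDerivation K fun i => C (u i)

theorem pderiv_polar [CommRing K] (u : σ → K) (j : σ) (F : MvPolynomial σ K) :
    pderiv j (polar u F) = polar u (pderiv j F) := by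
  classical
  have h : ⁅pderiv (R := K) j, polar u⁆ = 0 := by
    refine derivation_ext fun i => ?_
    rw [Derivation.commutator_apply, polar, mkDerivation_X, pderiv_C, pderiv_X, Pi.single_apply]
    split_ifs <;> simp
  simpa [Derivation.commutator_apply, sub_eq_zero] using DFunLike.congr_fun h F

theorem mkDerivation_eq_sum_pderiv_mul [Fintype σ] [CommSemiring K] (f : σ → MvPolynomial σ K)
    (F : MvPolynomial σ K) : mkDerivation K f F = ∑ i, pderiv i F * f i := by
  classical
  have hsum (G : MvPolynomial σ K) : (∑ i, f i • pderiv i : Derivation K _ _) G =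
      ∑ i, f i * pderiv i G :=
    (congrFun (map_sum (Derivation.coeFnAddMonoidHom (R := K) (A := MvPolynomial σ K)
      (M := MvPolynomial σ K)) _ Finset.univ) G).trans
      (Finset.sum_apply _ _ _)
  have h : mkDerivation K f = ∑ i, f i • pderiv i :=
    derivation_ext fun j => by simp [hsum, pderiv_X, Pi.single_apply]
  rw [h, hsum]
  exact Finset.sum_congr rfl fun _ _ => mul_comm _ _

theorem isHomogeneous_mkDerivation [Finite σ] [CommSemiring K] {f : σ → MvPolynomial σ K} {m n : ℕ}
    (hf : ∀ i, (f i).IsHomogeneous m) {F : MvPolynomial σ K} (hF : F.IsHomogeneous (n + 1)) :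
    (mkDerivation K f F).IsHomogeneous (n + m) := by
  cases nonempty_fintype σ
  rw [mkDerivation_eq_sum_pderiv_mul]
  exact IsHomogeneous.sum _ _ _ fun i _ => hF.pderiv.mul (hf i)

theorem polar_apply [Fintype σ] [CommSemiring K] (u : σ → K) (F : MvPolynomial σ K) :
    polar u F = ∑ i, u i • pderiv i F := by
  simp [polar, mkDerivation_eq_sum_pderiv_mul, smul_eq_C_mul, mul_comm]

theorem isHomogeneous_polar [Finite σ] [CommSemiring K] (u : σ → K) {F : MvPolynomial σ K} {n : ℕ}
    (hF : F.IsHomogeneous (n + 1)) : (polar u F).IsHomogeneous n :=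
  isHomogeneous_mkDerivation (fun _ => isHomogeneous_C _ _) hF

theorem polar_smul [Finite σ] [CommSemiring K] (r : K) (u : σ → K) (F : MvPolynomial σ K) :
    polar (r • u) F = r • polar u F := by
  cases nonempty_fintype σ
  simp [polar_apply, Finset.smul_sum, mul_smul]

theorem eval_polar_self [Finite σ] [CommSemiring K] {u : σ → K} {F : MvPolynomial σ K} {n : ℕ}
    (hF : F.IsHomogeneous n) : eval u (polar u F) = n * eval u F := by
  cases nonempty_fintype σ
  simpa [polar_apply, smul_eval] using congrArg (eval u) hF.sum_X_mul_pderiv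

theorem exists_eq_sum_X_mul [Fintype σ] [Field K] [CharZero K] {F : MvPolynomial σ K} {n : ℕ}
    (hF : F.IsHomogeneous (n + 1)) :
    ∃ G : σ → MvPolynomial σ K, (∀ i, (G i).IsHomogeneous n) ∧ F = ∑ i, X i * G i := by
  refine ⟨fun i => (n + 1 : K)⁻¹ • pderiv i F, fun i => ?_, ?_⟩
  · exact (homogeneousSubmodule σ K n).smul_mem _ hF.pderiv
  · have hn : (n + 1 : K) ≠ 0 := by exact_mod_cast n.succ_ne_zero
    simp only [mul_smul_comm, ← Finset.smul_sum, hF.sum_X_mul_pderiv, ← Nat.cast_smul_eq_nsmul K,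
      smul_smul, Nat.cast_succ, inv_mul_cancel₀ hn, one_smul]

theorem exists_eq_sum_minorForm_mul [Fintype σ] [Field K] [CharZero K] {u : σ → K} {k : σ}
    (hu : u k ≠ 0) {n : ℕ} {F : MvPolynomial σ K} (hF : F.IsHomogeneous (n + 1))
    (h : eval u F = 0) :
    ∃ G : σ → MvPolynomial σ K,
      (∀ j, (G j).IsHomogeneous n) ∧ F = ∑ j, minorForm u k j * G j := by
  obtain ⟨G, hG, rfl⟩ := exists_eq_sum_X_mul hF
  set H := ∑ j, u j • G j with H_def
  have hH : H.IsHomogeneous n :=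
    IsHomogeneous.sum _ _ _ fun j _ => (homogeneousSubmodule σ K n).smul_mem _ (hG j)
  have hH0 : eval u H = 0 := by simpa [H_def, smul_eval] using h
  have split : u k • ∑ j, X j * G j = ∑ j, minorForm u k j * G j + X k * H := by
    simp only [H_def, minorForm, sub_mul, Finset.sum_sub_distrib, Finset.smul_sum, smul_mul_assoc,
      Finset.mul_sum, mul_smul_comm, sub_add_cancel]
  obtain ⟨G', hG', e⟩ : ∃ G' : σ → MvPolynomial σ K, (∀ j, (X k * G' j).IsHomogeneous n) ∧
      H = ∑ j, minorForm u k j * G' j := by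
    match n with
    | 0 =>
      refine ⟨0, fun j => by simpa using isHomogeneous_zero σ K 0, ?_⟩
      simpa using eq_zero_of_isHomogeneous_zero_of_eval_eq_zero hH hH0
    | n + 1 =>
      obtain ⟨G', hG', e⟩ := exists_eq_sum_minorForm_mul hu hH hH0
      exact ⟨G', fun j => add_comm 1 n ▸ (isHomogeneous_X K k).mul (hG' j), e⟩
  refine ⟨fun j => (u k)⁻¹ • (G j + X k * G' j), fun j =>
    (homogeneousSubmodule σ K n).smul_mem _ ((hG j).add (hG' j)), ?_⟩
  rw [e, Finset.mul_sum, ← Finset.sum_add_distrib] at split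
  rw [← inv_smul_smul₀ hu (∑ j, X j * G j), split, Finset.smul_sum]
  exact Finset.sum_congr rfl fun j _ => by rw [mul_smul_comm, mul_add, mul_left_comm]

theorem mul_mem_of_minorForm_mul_mem [Finite σ] [Field K] [CharZero K] {u : σ → K} {k : σ}
    (hu : u k ≠ 0) {S : Submodule K (MvPolynomial σ K)} {q g : MvPolynomial σ K} {n : ℕ}
    (hg : g.IsHomogeneous n) (hgu : eval u g ≠ 0) (hq : q * g ∈ S)
    (hS : ∀ m, n = m + 1 → ∀ j (G : MvPolynomial σ K), G.IsHomogeneous m →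
      q * minorForm u k j * G ∈ S)
    {F : MvPolynomial σ K} (hF : F.IsHomogeneous n) : q * F ∈ S := by
  cases nonempty_fintype σ
  set r := eval u F / eval u g
  have hR : (F - r • g).IsHomogeneous n :=
    hF.sub ((homogeneousSubmodule σ K n).smul_mem r hg)
  have hR0 : eval u (F - r • g) = 0 := by simp [r, smul_eval, hgu]
  suffices q * (F - r • g) ∈ S by
    have := S.add_mem this (S.smul_mem r hq)
    rwa [mul_sub, mul_smul_comm, sub_add_cancel] at this
  match n with
  | 0 => simp [eq_zero_of_isHomogeneous_zero_of_eval_eq_zero hR hR0]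
  | n + 1 =>
    obtain ⟨G, hG, e⟩ := exists_eq_sum_minorForm_mul hu hR hR0
    rw [e, Finset.mul_sum]
    exact S.sum_mem fun j _ => mul_assoc q _ (G j) ▸ hS n rfl j (G j) (hG j)

/-- By Euler's relation the polars of `g` do not vanish at `u` either, so subtracting multiples of
them raises the order of vanishing of a form at `u` to three. -/
theorem mem_of_polar_mem [Finite σ] [Field K] [CharZero K] {u : σ → K} {k : σ} (hu : u k ≠ 0)
    {S : Submodule K (MvPolynomial σ K)} {g : MvPolynomial σ K} {n : ℕ}
    (hg : g.IsHomogeneous n) (hgu : eval u g ≠ 0) (mem : g ∈ S)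
    (polar_mem : ∀ m, n = m + 1 → ∀ j, minorForm u k j * polar u g ∈ S)
    (polar_polar_mem : ∀ m, n = m + 2 → ∀ i j,
      minorForm u k i * minorForm u k j * polar u (polar u g) ∈ S)
    (cubic_mem : ∀ m, n = m + 3 → ∀ i j l (G : MvPolynomial σ K), G.IsHomogeneous m →
      minorForm u k i * minorForm u k j * minorForm u k l * G ∈ S)
    {F : MvPolynomial σ K} (hF : F.IsHomogeneous n) : F ∈ S := by
  rw [← one_mul F]
  refine mul_mem_of_minorForm_mul_mem hu hg hgu (by rwa [one_mul]) ?_ hF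
  rintro n rfl i G hG
  have hg₁ := isHomogeneous_polar u hg
  have hgu₁ : eval u (polar u g) ≠ 0 := by
    rw [eval_polar_self hg]
    exact mul_ne_zero (Nat.cast_ne_zero.2 n.succ_ne_zero) hgu
  rw [one_mul]
  refine mul_mem_of_minorForm_mul_mem hu hg₁ hgu₁ (polar_mem n rfl i) ?_ hG
  rintro n rfl j G hG
  have hgu₂ : eval u (polar u (polar u g)) ≠ 0 := by
    rw [eval_polar_self hg₁]
    exact mul_ne_zero (Nat.cast_ne_zero.2 n.succ_ne_zero) hgu₁
  refine mul_mem_of_minorForm_mul_mem hu (isHomogeneous_polar u hg₁) hgu₂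
    (polar_polar_mem n rfl i j) ?_ hG
  rintro n rfl l G hG
  exact cubic_mem n rfl i j l G hG

end Forms

/-! ### 2-jets of polynomials along a curve -/

/-- The 2-jet `(F, F', F'')` of `F(Z(t))`. -/
def polyJet (z : Jet) : MvPolynomial (Fin 3) ℂ →ₗ[ℂ] Fin 3 → ℂ where
  toFun F := ![jetVal F z, jetDer F z, jetDer2 F z]
  map_add' F G := by
    funext k
    fin_cases k <;> simp [jetVal, jetDer, jetDer2, add_mul, Finset.sum_add_distrib]
    ring
  map_smul' r F := by
    funext k
    fin_cases k <;> simp [jetVal, jetDer, jetDer2, smul_eval, Finset.mul_sum, mul_assoc, mul_add]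

theorem polyJet_apply_zero (z : Jet) (F : MvPolynomial (Fin 3) ℂ) : polyJet z F 0 = eval (z 0) F :=
  rfl

theorem polyJet_apply_one (z : Jet) (F : MvPolynomial (Fin 3) ℂ) :
    polyJet z F 1 = ∑ j, eval (z 0) (pderiv j F) * z 1 j :=
  rfl

theorem polyJet_apply_two (z : Jet) (F : MvPolynomial (Fin 3) ℂ) :
    polyJet z F 2 = (∑ j, eval (z 0) (pderiv j F) * z 2 j) +
      ∑ j, ∑ k, eval (z 0) (pderiv k (pderiv j F)) * z 1 j * z 1 k :=
  rfl

theorem polyJet_C (z : Jet) (r : ℂ) : polyJet z (C r) = r • oneJet := by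
  funext k
  fin_cases k <;> simp [polyJet_apply_zero, polyJet_apply_one, polyJet_apply_two, oneJet]

theorem polyJet_X (z : Jet) (i : Fin 3) : polyJet z (X i) = fun k => z k i := by
  funext k
  fin_cases k <;>
    simp [polyJet_apply_zero, polyJet_apply_one, polyJet_apply_two, pderiv_X, Pi.single_apply,
      apply_ite]

theorem polyJet_mul (z : Jet) (F G : MvPolynomial (Fin 3) ℂ) :
    polyJet z (F * G) = mulJet (polyJet z F) (polyJet z G) := by
  funext k
  fin_cases k <;>
    simp [polyJet_apply_zero, polyJet_apply_one, polyJet_apply_two, mulJet, Fin.sum_univ_three] <;>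
    ring

theorem polyJet_polar_apply_zero (z : Jet) {F : MvPolynomial (Fin 3) ℂ} {n : ℕ}
    (hF : F.IsHomogeneous n) : polyJet z (polar (z 0) F) 0 = n * polyJet z F 0 :=
  eval_polar_self hF

theorem polyJet_polar_apply_one (z : Jet) {F : MvPolynomial (Fin 3) ℂ} {n : ℕ}
    (hF : F.IsHomogeneous (n + 1)) : polyJet z (polar (z 0) F) 1 = n * polyJet z F 1 := by
  simp only [polyJet_apply_one, pderiv_polar, Finset.mul_sum]
  refine Finset.sum_congr rfl fun j _ => ?_
  rw [eval_polar_self (hF.pderiv (i := j)), Nat.add_sub_cancel, mul_assoc]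

theorem mulJet_comm (x y : Fin 3 → ℂ) : mulJet x y = mulJet y x := by
  funext k
  fin_cases k <;> simp [mulJet] <;> ring

theorem mulJet_assoc (x y w : Fin 3 → ℂ) : mulJet (mulJet x y) w = mulJet x (mulJet y w) := by
  funext k
  fin_cases k <;> simp [mulJet] <;> ring

theorem mulJet_left_comm (x y w : Fin 3 → ℂ) : mulJet x (mulJet y w) = mulJet y (mulJet x w) := by
  rw [← mulJet_assoc, mulJet_comm x, mulJet_assoc]

theorem mulJet_add (x y w : Fin 3 → ℂ) : mulJet x (y + w) = mulJet x y + mulJet x w := by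
  funext k
  fin_cases k <;> simp [mulJet] <;> ring

theorem mulJet_smul (r : ℂ) (x y : Fin 3 → ℂ) : mulJet x (r • y) = r • mulJet x y := by
  funext k
  fin_cases k <;> simp [mulJet] <;> ring

theorem smul_mulJet (r : ℂ) (x y : Fin 3 → ℂ) : mulJet (r • x) y = r • mulJet x y := by
  rw [mulJet_comm, mulJet_smul, mulJet_comm]

theorem mulJet_sum {ι : Type*} (s : Finset ι) (x : Fin 3 → ℂ) (y : ι → Fin 3 → ℂ) :
    mulJet x (∑ i ∈ s, y i) = ∑ i ∈ s, mulJet x (y i) :=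
  map_sum (⟨⟨mulJet x, mulJet_add x⟩, fun r y => mulJet_smul r x y⟩ :
    (Fin 3 → ℂ) →ₗ[ℂ] Fin 3 → ℂ) y s

theorem oneJet_mulJet (x : Fin 3 → ℂ) : mulJet oneJet x = x := by
  funext k
  fin_cases k <;> simp [mulJet, oneJet]

theorem mulJet_left_cancel {x y w : Fin 3 → ℂ} (hx : x 0 ≠ 0) (h : mulJet x y = mulJet x w) :
    y = w := by
  rw [← oneJet_mulJet y, ← oneJet_mulJet w, ← invJet_mul x hx, mulJet_assoc, h, mulJet_assoc]

/-- The 2-jet of a function `s` with `s(0) = 1`, `(log s)'(0) = η 0` and `(log s)''(0) = η 1`. -/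
def expJet (η : Fin 2 → ℂ) : Fin 3 → ℂ := ![1, η 0, η 1 + η 0 ^ 2]

theorem expJet_zero : expJet 0 = oneJet := by
  simp [expJet, oneJet]

theorem expJet_add (η θ : Fin 2 → ℂ) : expJet (η + θ) = mulJet (expJet η) (expJet θ) := by
  funext k
  fin_cases k <;> simp [expJet, mulJet] <;> ring

theorem smul_expJet_logJet {l : Fin 3 → ℂ} (hl : l 0 ≠ 0) : l 0 • expJet (logJet l) = l := by
  funext k
  fin_cases k <;> simp [expJet, logJet] <;> field_simp

theorem polyJet_X_scaleJet (l : Fin 3 → ℂ) (z : Jet) (i : Fin 3) :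
    polyJet (scaleJet l z) (X i) = mulJet l (polyJet z (X i)) := by
  simp only [polyJet_X]
  funext k
  fin_cases k <;> simp [scaleJet, mulJet]

theorem polyJet_scaleJet {l : Fin 3 → ℂ} (hl : l 0 ≠ 0) (z : Jet) {n : ℕ}
    {F : MvPolynomial (Fin 3) ℂ} (hF : F.IsHomogeneous n) :
    polyJet (scaleJet l z) F = l 0 ^ n • mulJet (expJet ((n : ℂ) • logJet l)) (polyJet z F) := by
  induction n generalizing F with
  | zero =>
    rw [totalDegree_eq_zero_iff_eq_C.1 ((totalDegree_zero_iff_isHomogeneous (Fin 3)).2 hF)]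
    simp [polyJet_C, expJet_zero, oneJet_mulJet]
  | succ n ih =>
    obtain ⟨G, hG, rfl⟩ := exists_eq_sum_X_mul hF
    have hl' : mulJet (expJet ((n : ℂ) • logJet l)) l =
        l 0 • expJet (((n + 1 : ℕ) : ℂ) • logJet l) := by
      rw [Nat.cast_succ, add_smul, one_smul, expJet_add, ← mulJet_smul, smul_expJet_logJet hl]
    simp only [map_sum, polyJet_mul, mulJet_sum, Finset.smul_sum]
    refine Finset.sum_congr rfl fun i _ => ?_
    rw [polyJet_X_scaleJet, ih (hG i), mulJet_smul, pow_succ, mul_smul, ← smul_mulJet (l 0), ← hl',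
      mulJet_comm _ l, mulJet_assoc, mulJet_assoc, mulJet_left_comm (polyJet z (X i))]

/-- The vector field `∑ᵢ (M Z)ᵢ ∂/∂Zᵢ`, as a derivation of the homogeneous coordinate ring. -/
def linearField (M : Matrix (Fin 3) (Fin 3) ℂ) :
    Derivation ℂ (MvPolynomial (Fin 3) ℂ) (MvPolynomial (Fin 3) ℂ) :=
  mkDerivation ℂ fun i => ∑ j, C (M i j) * X j

theorem isHomogeneous_linearField (M : Matrix (Fin 3) (Fin 3) ℂ) {F : MvPolynomial (Fin 3) ℂ}
    {n : ℕ} (hF : F.IsHomogeneous (n + 1)) : (linearField M F).IsHomogeneous (n + 1) :=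
  isHomogeneous_mkDerivation
    (fun _ => IsHomogeneous.sum _ _ _ fun _ _ => isHomogeneous_C_mul_X _ _) hF

theorem polyJet_linearField_X (M : Matrix (Fin 3) (Fin 3) ℂ) (z : Jet) (i : Fin 3) :
    polyJet z (linearField M (X i)) = fun k => M.mulVec (z k) i := by
  funext k
  simp only [linearField, mkDerivation_X, map_sum, Finset.sum_apply, ← smul_eq_C_mul, map_smul,
    polyJet_X, Pi.smul_apply, smul_eq_mul, Matrix.mulVec, dotProduct]

theorem hasDerivAt_polyJet_linearField (M : Matrix (Fin 3) (Fin 3) ℂ) (z : Jet)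
    (F : MvPolynomial (Fin 3) ℂ) :
    HasDerivAt (fun t : ℂ => polyJet (z + t • fun k => M.mulVec (z k)) F)
      (polyJet z (linearField M F)) 0 := by
  induction F using MvPolynomial.induction_on with
  | C r =>
    simp only [polyJet_C, linearField, derivation_C, map_zero]
    exact hasDerivAt_const _ _
  | add F G hF hG =>
    simp only [map_add]
    exact hF.add hG
  | mul_X F i hF =>
    have hX (k : Fin 3) : HasDerivAt (fun t : ℂ => z k i + t * M.mulVec (z k) i)
        (M.mulVec (z k) i) 0 := by
      simpa using ((hasDerivAt_id (0 : ℂ)).mul_const (M.mulVec (z k) i)).const_add (z k i)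
    rw [hasDerivAt_pi] at hF ⊢
    simp only [polyJet_mul, polyJet_X, Derivation.leibniz, map_add, smul_eq_mul,
      polyJet_linearField_X]
    intro k
    fin_cases k
    · refine ((hF 0).mul (hX 0)).congr_deriv ?_
      simp [mulJet]
      ring
    · refine (((hF 0).mul (hX 1)).add ((hF 1).mul (hX 0))).congr_deriv ?_
      simp [mulJet]
      ring
    · refine ((((hF 0).mul (hX 2)).add (((hF 1).const_mul 2).mul (hX 1))).add
        ((hF 2).mul (hX 0))).congr_deriv ?_
      simp [mulJet]
      ring

/-! ### Forms and their coefficients -/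

/-- The coefficients of a polynomial at the monomials of degree `d`. -/
def coefs (d : ℕ) : MvPolynomial (Fin 3) ℂ →ₗ[ℂ] Mon d → ℂ :=
  LinearMap.pi fun α => lcoeff ℂ (Finsupp.equivFunOnFinite.symm α.1)

theorem coeff_form {d : ℕ} (a : Mon d → ℂ) (m : Fin 3 →₀ ℕ) :
    coeff m (form a) = ∑ α : Mon d, if Finsupp.equivFunOnFinite.symm α.1 = m then a α else 0 := by
  have prod_X_pow_eq (α : Fin 3 → ℕ) : (∏ i, X i ^ α i : MvPolynomial (Fin 3) ℂ) =
      monomial (Finsupp.equivFunOnFinite.symm α) 1 := by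
    rw [monomial_eq, Finsupp.prod_fintype _ _ (by simp)]
    simp
  simp [form, prod_X_pow_eq, coeff_sum, coeff_C_mul, coeff_monomial]

theorem coefs_form {d : ℕ} (a : Mon d → ℂ) : coefs d (form a) = a := by
  funext α
  simp [coefs, coeff_form]

theorem isHomogeneous_form {d : ℕ} (a : Mon d → ℂ) : (form a).IsHomogeneous d := by
  refine IsHomogeneous.sum _ _ _ fun α _ => ?_
  have hα : ∑ i, α.1 i = d := (Finset.mem_piAntidiag.1 α.2).1
  have := (isHomogeneous_C (Fin 3) (a α)).mul
    (IsHomogeneous.prod Finset.univ (fun i => (X i ^ α.1 i : MvPolynomial (Fin 3) ℂ))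
      (fun i => α.1 i)
      fun i _ => by simpa using (isHomogeneous_X ℂ i).pow (α.1 i))
  simpa [hα] using this

theorem form_coefs {d : ℕ} {F : MvPolynomial (Fin 3) ℂ} (hF : F.IsHomogeneous d) :
    form (coefs d F) = F := by
  ext m
  by_cases hm : ∑ i, m i = d
  · have hα : (m : Fin 3 → ℕ) ∈ Finset.piAntidiag (Finset.univ : Finset (Fin 3)) d := by
      simpa [Finset.mem_piAntidiag] using hm
    simpa [coefs] using congrFun (coefs_form (coefs d F)) ⟨m, hα⟩
  · have hdeg : m.degree ≠ d := by rwa [Finsupp.degree_eq_sum]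
    rw [(isHomogeneous_form _).coeff_eq_zero hdeg, hF.coeff_eq_zero hdeg]

/-- `form` as a linear map. -/
def formLin (d : ℕ) : (Mon d → ℂ) →ₗ[ℂ] MvPolynomial (Fin 3) ℂ where
  toFun := form
  map_add' a b := by simp [form, add_mul, Finset.sum_add_distrib]
  map_smul' r a := by simp [form, smul_eq_C_mul, Finset.mul_sum, mul_assoc]

theorem form_add {d : ℕ} (a b : Mon d → ℂ) : form (a + b) = form a + form b :=
  (formLin d).map_add a b

theorem form_smul {d : ℕ} (r : ℂ) (a : Mon d → ℂ) : form (r • a) = r • form a :=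
  (formLin d).map_smul r a

theorem form_zero {d : ℕ} : form (0 : Mon d → ℂ) = 0 :=
  (formLin d).map_zero

/-! ### Polynomial maps -/

section PolyMap

variable {V E F G : Type*} [AddCommGroup V] [Module ℂ V] [AddCommGroup E] [Module ℂ E]
  [AddCommGroup F] [Module ℂ F] [AddCommGroup G] [Module ℂ G]

/-- The polynomial maps between two vector spaces; those with values in an infinite-dimensional
space are required to take their values in a finite-dimensional subspace. -/
@[fun_prop]
def IsPolyMap (g : V → E) : Prop :=
  g ∈ Submodule.span (polyFun V) (Set.range (Function.const V))

theorem IsPolyMap.smul {f : V → ℂ} (hf : f ∈ polyFun V) {g : V → E} (hg : IsPolyMap g) :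
    IsPolyMap fun p => f p • g p :=
  Submodule.smul_mem _ (⟨f, hf⟩ : polyFun V) hg

@[fun_prop]
theorem isPolyMap_const (e : E) : IsPolyMap fun _ : V => e :=
  Submodule.subset_span ⟨e, rfl⟩

@[fun_prop]
theorem IsPolyMap.add {g h : V → E} (hg : IsPolyMap g) (hh : IsPolyMap h) :
    IsPolyMap fun p => g p + h p :=
  Submodule.add_mem _ hg hh

@[fun_prop]
theorem IsPolyMap.sub {g h : V → E} (hg : IsPolyMap g) (hh : IsPolyMap h) :
    IsPolyMap fun p => g p - h p :=
  Submodule.sub_mem _ hg hh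

@[fun_prop]
theorem IsPolyMap.sum {ι : Type*} {s : Finset ι} {g : ι → V → E} (h : ∀ i, IsPolyMap (g i)) :
    IsPolyMap fun p => ∑ i ∈ s, g i p := by
  have : ∑ i ∈ s, g i = fun p => ∑ i ∈ s, g i p := funext fun p => Finset.sum_apply p s g
  exact this ▸ Submodule.sum_mem _ fun i _ => h i

theorem IsPolyMap.induction {P : (V → E) → Prop} (const : ∀ e : E, P fun _ => e)
    (add : ∀ g h, P g → P h → P fun p => g p + h p)
    (smul : ∀ f ∈ polyFun V, ∀ g, P g → P fun p => f p • g p) {g : V → E} (hg : IsPolyMap g) :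
    P g := by
  refine Submodule.span_induction (p := fun g _ => P g) ?_ (const 0)
    (fun g h _ _ hg hh => add g h hg hh) (fun f g _ hg => smul f.1 f.2 g hg) hg
  rintro _ ⟨e, rfl⟩
  exact const e

theorem isPolyMap_iff_mem_polyFun {f : V → ℂ} : IsPolyMap f ↔ f ∈ polyFun V := by
  constructor
  · intro hf
    refine hf.induction (fun r => (polyFun V).algebraMap_mem r) (fun g h => add_mem)
      fun f hf g hg => mul_mem hf hg
  · intro hf
    simpa using (isPolyMap_const (1 : ℂ)).smul hf

theorem IsPolyMap.map {g : V → E} (hg : IsPolyMap g) (L : E →ₗ[ℂ] F) :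
    IsPolyMap fun p => L (g p) := by
  refine hg.induction (P := fun g => IsPolyMap fun p => L (g p)) (fun e => isPolyMap_const (L e))
    (fun g h hg hh => ?_) fun f hf g hg => ?_
  · simpa only [map_add] using hg.add hh
  · simpa only [map_smul] using hg.smul hf

theorem IsPolyMap.bilin {g : V → E} {h : V → F} (hg : IsPolyMap g) (hh : IsPolyMap h)
    (B : E →ₗ[ℂ] F →ₗ[ℂ] G) : IsPolyMap fun p => B (g p) (h p) := by
  refine hg.induction (P := fun g => IsPolyMap fun p => B (g p) (h p))
    (fun e => hh.map (B e)) (fun g g' hg hg' => ?_) fun f hf g hg => ?_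
  · simpa only [map_add, LinearMap.add_apply] using hg.add hg'
  · simpa only [map_smul, LinearMap.smul_apply] using hg.smul hf

@[fun_prop]
theorem isPolyMap_id [FiniteDimensional ℂ V] : IsPolyMap fun p : V => p := by
  let b := Module.finBasis ℂ V
  have h : (fun p : V => p) = fun p => ∑ i, b.coord i p • b i := by
    funext p
    simp [b.sum_repr]
  rw [h]
  exact IsPolyMap.sum fun i =>
    (isPolyMap_const (b i)).smul (Algebra.subset_adjoin ⟨b.coord i, rfl⟩)

@[fun_prop]
theorem IsPolyMap.comp {g : E → F} {h : V → E} (hg : IsPolyMap g) (hh : IsPolyMap h) :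
    IsPolyMap fun p => g (h p) := by
  refine hg.induction (P := fun g => IsPolyMap fun p => g (h p)) isPolyMap_const
    (fun g g' hg hg' => hg.add hg') fun f hf g hg => hg.smul ?_
  induction hf using Algebra.adjoin_induction with
  | mem f hf =>
    obtain ⟨φ, rfl⟩ := hf
    exact isPolyMap_iff_mem_polyFun.1 (hh.map φ)
  | algebraMap r => exact (polyFun V).algebraMap_mem r
  | add f f' _ _ hf hf' => exact add_mem hf hf'
  | mul f f' _ _ hf hf' => exact mul_mem hf hf'

@[fun_prop]
theorem IsPolyMap.fun_smul {f : V → ℂ} {g : V → E} (hf : IsPolyMap f) (hg : IsPolyMap g) :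
    IsPolyMap fun p => f p • g p :=
  hg.smul (isPolyMap_iff_mem_polyFun.1 hf)

@[fun_prop]
theorem IsPolyMap.mul {A : Type*} [Ring A] [Algebra ℂ A] {g h : V → A} (hg : IsPolyMap g)
    (hh : IsPolyMap h) : IsPolyMap fun p => g p * h p :=
  hg.bilin hh (LinearMap.mul ℂ A)

@[fun_prop]
theorem IsPolyMap.pow {A : Type*} [Ring A] [Algebra ℂ A] {g : V → A} (hg : IsPolyMap g) (n : ℕ) :
    IsPolyMap fun p => g p ^ n := by
  induction n with
  | zero => simpa using isPolyMap_const (1 : A)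
  | succ n ih => simpa only [pow_succ] using ih.mul hg

@[fun_prop]
theorem IsPolyMap.prod {A ι : Type*} [CommRing A] [Algebra ℂ A] {s : Finset ι} {g : ι → V → A}
    (h : ∀ i, IsPolyMap (g i)) : IsPolyMap fun p => ∏ i ∈ s, g i p := by
  classical
  induction s using Finset.induction_on with
  | empty => simpa using isPolyMap_const (1 : A)
  | insert i s hi ih => simpa only [Finset.prod_insert hi] using (h i).mul ih

@[fun_prop]
theorem isPolyMap_apply {ι : Type*} [Finite ι] {E : ι → Type*} [∀ i, AddCommGroup (E i)]
    [∀ i, Module ℂ (E i)] [∀ i, FiniteDimensional ℂ (E i)] (i : ι) :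
    IsPolyMap fun p : ∀ i, E i => p i :=
  isPolyMap_id.map (LinearMap.proj i : (∀ i, E i) →ₗ[ℂ] E i)

@[fun_prop]
theorem isPolyMap_pi {ι : Type*} [Finite ι] {E : ι → Type*} [∀ i, AddCommGroup (E i)]
    [∀ i, Module ℂ (E i)] {g : V → ∀ i, E i} (h : ∀ i, IsPolyMap fun p => g p i) :
    IsPolyMap g := by
  classical
  cases nonempty_fintype ι
  have : g = fun p => ∑ i, LinearMap.single ℂ E i (g p i) := by
    funext p j
    simp [Finset.sum_apply]
  rw [this]
  exact IsPolyMap.sum fun i => (h i).map _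

@[fun_prop]
theorem IsPolyMap.vecCons {n : ℕ} {g : V → E} {h : V → Fin n → E} (hg : IsPolyMap g)
    (hh : IsPolyMap h) : IsPolyMap fun p => Matrix.vecCons (g p) (h p) :=
  isPolyMap_pi (Fin.cases hg fun i => hh.map (LinearMap.proj i))

@[fun_prop]
theorem IsPolyMap.fst {g : V → E × F} (hg : IsPolyMap g) : IsPolyMap fun p => (g p).1 :=
  hg.map (LinearMap.fst ℂ E F)

@[fun_prop]
theorem IsPolyMap.snd {g : V → E × F} (hg : IsPolyMap g) : IsPolyMap fun p => (g p).2 :=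
  hg.map (LinearMap.snd ℂ E F)

@[fun_prop]
theorem IsPolyMap.prodMk {g : V → E} {h : V → F} (hg : IsPolyMap g) (hh : IsPolyMap h) :
    IsPolyMap fun p => (g p, h p) := by
  simpa using (hg.map (LinearMap.inl ℂ E F)).add (hh.map (LinearMap.inr ℂ E F))

@[fun_prop]
theorem IsPolyMap.eval {σ : Type*} {u : V → σ → ℂ} (hu : IsPolyMap u) {g : V → MvPolynomial σ ℂ}
    (hg : IsPolyMap g) : IsPolyMap fun p => eval (u p) (g p) := by
  refine hg.induction (P := fun g => IsPolyMap fun p => MvPolynomial.eval (u p) (g p))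
    (fun e => ?_) (fun g h hg hh => ?_) fun f hf g hg => ?_
  · induction e using MvPolynomial.induction_on with
    | C r => simpa only [eval_C] using isPolyMap_const r
    | add p q hp hq => simpa only [map_add] using hp.add hq
    | mul_X p i hp =>
      have hi : IsPolyMap fun p => u p i := hu.map (LinearMap.proj i)
      simpa only [map_mul, eval_X] using hp.mul hi
  · simpa only [map_add] using hg.add hh
  · simpa only [smul_eval] using (isPolyMap_iff_mem_polyFun.2 hf).mul hg

theorem IsPolyMap.differentiable {V E : Type*} [NormedAddCommGroup V] [NormedSpace ℂ V]
    [FiniteDimensional ℂ V] [NormedAddCommGroup E] [NormedSpace ℂ E] {g : V → E}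
    (hg : IsPolyMap g) : Differentiable ℂ g := by
  refine hg.induction (fun e => differentiable_const e) (fun g h hg hh => hg.add hh)
    fun f hf g hg => Differentiable.smul ?_ hg
  induction hf using Algebra.adjoin_induction with
  | mem f h =>
    obtain ⟨φ, rfl⟩ := h
    exact (LinearMap.toContinuousLinearMap φ).differentiable
  | algebraMap r => exact differentiable_const r
  | add f g _ _ hf hg => exact hf.add hg
  | mul f g _ _ hf hg => exact hf.mul hg

end PolyMap

section PolyMapJet

variable {V : Type*} [AddCommGroup V] [Module ℂ V]

@[fun_prop]
theorem IsPolyMap.form {n : ℕ} {a : V → Mon n → ℂ} (ha : IsPolyMap a) :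
    IsPolyMap fun p => form (a p) :=
  ha.map (formLin n)

@[fun_prop]
theorem IsPolyMap.coefs {n : ℕ} {F : V → MvPolynomial (Fin 3) ℂ} (hF : IsPolyMap F) :
    IsPolyMap fun p => coefs n (F p) :=
  hF.map (LogJets.coefs n)

@[fun_prop]
theorem IsPolyMap.derivation {σ : Type*} (D : Derivation ℂ (MvPolynomial σ ℂ) (MvPolynomial σ ℂ))
    {F : V → MvPolynomial σ ℂ} (hF : IsPolyMap F) : IsPolyMap fun p => D (F p) :=
  hF.map D.toLinearMap

@[fun_prop]
theorem IsPolyMap.polar {σ : Type*} [Finite σ] {u : V → σ → ℂ} (hu : IsPolyMap u)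
    {F : V → MvPolynomial σ ℂ} (hF : IsPolyMap F) : IsPolyMap fun p => polar (u p) (F p) := by
  cases nonempty_fintype σ
  simp only [polar_apply]
  fun_prop

@[fun_prop]
theorem IsPolyMap.minorForm {σ : Type*} [Finite σ] {u : V → σ → ℂ} (hu : IsPolyMap u) (k j : σ) :
    IsPolyMap fun p => minorForm (u p) k j := by
  unfold LogJets.minorForm
  fun_prop

@[fun_prop]
theorem IsPolyMap.scaleJet {l : V → Fin 3 → ℂ} (hl : IsPolyMap l) {z : V → Jet}
    (hz : IsPolyMap z) : IsPolyMap fun p => scaleJet (l p) (z p) := by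
  unfold LogJets.scaleJet
  fun_prop

@[fun_prop]
theorem IsPolyMap.polyJet {z : V → Jet} (hz : IsPolyMap z) {F : V → MvPolynomial (Fin 3) ℂ}
    (hF : IsPolyMap F) : IsPolyMap fun p => polyJet (z p) (F p) := by
  simp only [LogJets.polyJet, LinearMap.coe_mk, AddHom.coe_mk, jetVal, jetDer, jetDer2]
  fun_prop

end PolyMapJet

/-! ### The sections `s_c` along a jet and the tangent spaces of the cone -/

section Line

variable {E F : Type*} [NormedAddCommGroup E] [NormedSpace ℂ E] [NormedAddCommGroup F]
  [NormedSpace ℂ F]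

theorem hasDerivAt_line (p w : E) : HasDerivAt (fun t : ℂ => p + t • w) w 0 := by
  simpa using ((hasDerivAt_id (0 : ℂ)).smul_const w).const_add p

theorem hasDerivAt_comp_line {f : E → F} (hf : Differentiable ℂ f) (p w : E) :
    HasDerivAt (fun t : ℂ => f (p + t • w)) (fderiv ℂ f p w) 0 :=
  (hf p).hasFDerivAt.comp_hasDerivAt_of_eq 0 (hasDerivAt_line p w) (by simp)

end Line

section Cone

variable {d : Fin 2 → ℕ} {c : Fin 2} {p : Amb d}

/-- The 2-jet of the section `s_c = ∑ a⁽ᶜ⁾_α Z ^ α` along the curve. -/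
def sectionJet (d : Fin 2 → ℕ) (c : Fin 2) (p : Amb d) : Fin 3 → ℂ := polyJet p.1 (form (p.2.1 c))

@[fun_prop]
theorem isPolyMap_sectionJet : IsPolyMap (sectionJet d c) := by
  unfold sectionJet
  fun_prop

theorem eqOne_eq (p : Amb d) :
    eqOne d c p = sectionJet d c p 1 - sectionJet d c p 0 * p.2.2 c 0 :=
  rfl

theorem eqTwo_eq (p : Amb d) :
    eqTwo d c p = sectionJet d c p 2 - sectionJet d c p 0 * (p.2.2 c 1 + p.2.2 c 0 ^ 2) :=
  rfl

theorem eqOne_eq_zero_and_eqTwo_eq_zero_iff : eqOne d c p = 0 ∧ eqTwo d c p = 0 ↔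
    sectionJet d c p = sectionJet d c p 0 • expJet (p.2.2 c) := by
  simp [funext_iff, Fin.forall_fin_succ, expJet, eqOne_eq, eqTwo_eq, sub_eq_zero]

theorem sectionJet_eq (hp : p ∈ cone d) (c : Fin 2) :
    sectionJet d c p = sectionJet d c p 0 • expJet (p.2.2 c) :=
  eqOne_eq_zero_and_eqTwo_eq_zero_iff.1 (hp.2.2 c)

theorem sectionJet_act {l : Fin 3 → ℂ} (hl : l 0 ≠ 0) (μ : Fin 2 → ℂ) (p : Amb d) (c : Fin 2) :
    sectionJet d c (act d l μ p) =
      (l 0 ^ d c * μ c) • mulJet (expJet ((d c : ℂ) • logJet l)) (sectionJet d c p) := by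
  simp only [sectionJet, act, form_smul, map_smul,
    polyJet_scaleJet hl p.1 (isHomogeneous_form (p.2.1 c)), smul_smul, mul_comm]

theorem act_mem_cone {l : Fin 3 → ℂ} (hl : l 0 ≠ 0) {μ : Fin 2 → ℂ} (hμ : ∀ c, μ c ≠ 0)
    (hp : p ∈ cone d) : act d l μ p ∈ cone d := by
  refine ⟨smul_ne_zero hl hp.1, fun c => smul_ne_zero (hμ c) (hp.2.1 c), fun c => ?_⟩
  have h0 (x : ℂ) : mulJet (expJet ((d c : ℂ) • logJet l)) (x • expJet (p.2.2 c)) =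
      x • expJet ((act d l μ p).2.2 c) := by
    rw [mulJet_smul, ← expJet_add, add_comm]
    rfl
  rw [eqOne_eq_zero_and_eqTwo_eq_zero_iff, sectionJet_act hl, sectionJet_eq hp c, h0]
  simp [expJet, mul_assoc]

/-- The tangent space of the cone at `p`: the kernel of the differentials of its equations. -/
def coneTangent (d : Fin 2 → ℕ) (p : Amb d) : Submodule ℂ (Amb d) where
  carrier := {w | ∀ c, fderiv ℂ (eqOne d c) p w = 0 ∧ fderiv ℂ (eqTwo d c) p w = 0}
  add_mem' hv hw c := by simp [hv c, hw c]
  zero_mem' c := by simp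
  smul_mem' r w hw c := by simp [hw c]

theorem differentiable_eqOne : Differentiable ℂ (eqOne d c) := by
  refine IsPolyMap.differentiable ?_
  simp only [funext eqOne_eq]
  fun_prop

theorem differentiable_eqTwo : Differentiable ℂ (eqTwo d c) := by
  refine IsPolyMap.differentiable ?_
  simp only [funext eqTwo_eq]
  fun_prop

theorem mem_coneTangent_iff {w : Amb d} : w ∈ coneTangent d p ↔
    ∀ c, fderiv ℂ (sectionJet d c) p w = mulJet (expJet (p.2.2 c))
      ![fderiv ℂ (sectionJet d c) p w 0, sectionJet d c p 0 * w.2.2 c 0,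
        sectionJet d c p 0 * w.2.2 c 1] := by
  refine forall_congr' fun c => ?_
  set δ := fderiv ℂ (sectionJet d c) p w
  have hs (k : Fin 3) : HasDerivAt (fun t : ℂ => sectionJet d c (p + t • w) k) (δ k) 0 :=
    hasDerivAt_pi.1 (hasDerivAt_comp_line isPolyMap_sectionJet.differentiable p w) k
  have hη (k : Fin 2) : HasDerivAt (fun t : ℂ => p.2.2 c k + t * w.2.2 c k) (w.2.2 c k) 0 :=
    hasDerivAt_line (p.2.2 c k) (w.2.2 c k)
  have h₁ : fderiv ℂ (eqOne d c) p w =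
      δ 1 - (δ 0 * p.2.2 c 0 + sectionJet d c p 0 * w.2.2 c 0) := by
    refine (hasDerivAt_comp_line differentiable_eqOne p w).unique ?_
    refine ((hs 1).sub ((hs 0).mul (hη 0))).congr_deriv ?_
    simp
  have h₂ : fderiv ℂ (eqTwo d c) p w = δ 2 - (δ 0 * (p.2.2 c 1 + p.2.2 c 0 ^ 2) +
      sectionJet d c p 0 * (w.2.2 c 1 + 2 * p.2.2 c 0 * w.2.2 c 0)) := by
    refine (hasDerivAt_comp_line differentiable_eqTwo p w).unique ?_
    refine ((hs 2).sub ((hs 0).mul ((hη 1).add ((hη 0).pow 2)))).congr_deriv ?_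
    simp
  have h : mulJet (expJet (p.2.2 c))
      ![δ 0, sectionJet d c p 0 * w.2.2 c 0, sectionJet d c p 0 * w.2.2 c 1] =
      ![δ 0, δ 0 * p.2.2 c 0 + sectionJet d c p 0 * w.2.2 c 0,
        δ 0 * (p.2.2 c 1 + p.2.2 c 0 ^ 2) +
          sectionJet d c p 0 * (w.2.2 c 1 + 2 * p.2.2 c 0 * w.2.2 c 0)] := by
    funext k
    fin_cases k <;> simp [mulJet, expJet] <;> ring
  simp [h₁, h₂, h, funext_iff, Fin.forall_fin_succ, sub_eq_zero]

theorem fderiv_sectionJet {M : Matrix (Fin 3) (Fin 3) ℂ} {w : Amb d}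
    (hw : w.1 = fun k => M.mulVec (p.1 k)) (c : Fin 2) :
    fderiv ℂ (sectionJet d c) p w =
      polyJet p.1 (linearField M (form (p.2.1 c)) + form (w.2.1 c)) := by
  refine (hasDerivAt_comp_line isPolyMap_sectionJet.differentiable p w).unique ?_
  have h₁ := hasDerivAt_polyJet_linearField M p.1 (form (p.2.1 c))
  have h₂ := (hasDerivAt_id (0 : ℂ)).smul
    (hasDerivAt_polyJet_linearField M p.1 (form (w.2.1 c)))
  refine ((h₁.add h₂).congr_deriv ?_).congr_of_eventuallyEq
    (Filter.Eventually.of_forall fun t => ?_)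
  · simp
  · simp [sectionJet, form_add, form_smul, hw]

theorem fderiv_sectionJet_of_vertical {w : Amb d} (hw : w.1 = 0) (c : Fin 2) :
    fderiv ℂ (sectionJet d c) p w = polyJet p.1 (form (w.2.1 c)) := by
  rw [fderiv_sectionJet (M := 0) (by simp [hw]; rfl)]
  simp [linearField, mkDerivation_eq_sum_pderiv_mul]

theorem eq_zero_of_mem_coneTangent (hs : ∀ c, sectionJet d c p 0 ≠ 0) {w : Amb d}
    (hw : w ∈ coneTangent d p) (hz : w.1 = 0) (ha : w.2.1 = 0) : w = 0 := by
  have hδ (c : Fin 2) : fderiv ℂ (sectionJet d c) p w = 0 := by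
    rw [fderiv_sectionJet_of_vertical hz, ha, Pi.zero_apply, form_zero, map_zero]
  have hη (c : Fin 2) : w.2.2 c = 0 := by
    have h := mem_coneTangent_iff.1 hw c
    rw [hδ] at h
    have h₁ : w.2.2 c 0 = 0 := by simpa [mulJet, expJet, hs c] using congrFun h 1
    have h₂ : w.2.2 c 1 = 0 := by simpa [mulJet, expJet, hs c, h₁] using congrFun h 2
    exact funext (Fin.forall_fin_two.2 ⟨h₁, h₂⟩)
  exact Prod.ext hz (Prod.ext ha (funext hη))

end Cone

/-! ### The normalization of homogeneous coordinates and its differential -/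

section Charts

variable {d : Fin 2 → ℕ} {χ : Chart d} {l : Fin 3 → ℂ} {μ : Fin 2 → ℂ} {p : Amb d}

theorem isOpen_domain (χ : Chart d) : IsOpen (domain d χ) := by
  simp only [domain, Set.ofPred_and, Set.ofPred_forall]
  refine IsOpen.inter ?_ (isOpen_iInter_of_finite fun c => ?_) <;>
  exact isOpen_ne_fun (by fun_prop) (by fun_prop)

theorem slice_subset_domain : slice d χ ⊆ domain d χ := fun p hp =>
  ⟨by simp [hp.2.1], fun c => by simp [hp.2.2.2.2 c]⟩

theorem act_mem_domain (hl : l 0 ≠ 0) (hμ : ∀ c, μ c ≠ 0) (hp : p ∈ domain d χ) :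
    act d l μ p ∈ domain d χ :=
  ⟨mul_ne_zero hl hp.1, fun c => mul_ne_zero (hμ c) (hp.2 c)⟩

theorem act_apply_chart (l : Fin 3 → ℂ) (μ : Fin 2 → ℂ) (p : Amb d) (i : Fin 3) :
    (fun k => (act d l μ p).1 k i) = mulJet l fun k => p.1 k i := by
  rw [← polyJet_X, ← polyJet_X, ← polyJet_X_scaleJet]
  rfl

theorem invJet_mulJet {x : Fin 3 → ℂ} (hl : l 0 ≠ 0) (hx : x 0 ≠ 0) :
    mulJet (invJet (mulJet l x)) l = invJet x := by
  refine mulJet_left_cancel hx ?_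
  rw [mulJet_comm x, mulJet_comm x, invJet_mul x hx, mulJet_assoc,
    invJet_mul _ (mulJet_ne l x hl hx)]

theorem normalize_act (hl : l 0 ≠ 0) (hμ : ∀ c, μ c ≠ 0) (hp : p ∈ domain d χ) :
    normalize d χ (act d l μ p) = normalize d χ p := by
  have h : ((fun c => ((act d l μ p).2.1 c (χ.2 c))⁻¹) * μ) = fun c => (p.2.1 c (χ.2 c))⁻¹ := by
    funext c
    simp [act, hμ c]
  rw [normalize, act_apply_chart, act_act d _ _ _ _ (invJet_ne _ (mulJet_ne _ _ hl hp.1)) hl,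
    invJet_mulJet hl hp.1, h, normalize]

theorem normalize_mem_slice (hp : p ∈ cone d) (hpχ : p ∈ domain d χ) :
    normalize d χ p ∈ slice d χ := by
  have hjet := act_apply_chart (invJet fun k => p.1 k χ.1) (fun c => (p.2.1 c (χ.2 c))⁻¹) p χ.1
  rw [invJet_mul _ hpχ.1] at hjet
  exact ⟨act_mem_cone (invJet_ne _ hpχ.1) (fun c => inv_ne_zero (hpχ.2 c)) hp, congrFun hjet 0,
    congrFun hjet 1, congrFun hjet 2, fun c => inv_mul_cancel₀ (hpχ.2 c)⟩

theorem normalize_eq_self (hz : (fun k => p.1 k χ.1) = oneJet) (ha : ∀ c, p.2.1 c (χ.2 c) = 1) :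
    normalize d χ p = p := by
  have h : invJet oneJet = oneJet := by
    funext k
    fin_cases k <;> simp [invJet, oneJet]
  have h' : (fun c => (p.2.1 c (χ.2 c))⁻¹) = 1 := by
    funext c
    simp [ha c]
  rw [normalize, hz, h, h', act_one]

theorem coord_eq_oneJet (hp : p ∈ slice d χ) : (fun k => p.1 k χ.1) = oneJet :=
  funext (Fin.forall_fin_succ.2 ⟨hp.2.1, Fin.forall_fin_two.2 ⟨hp.2.2.1, hp.2.2.2.1⟩⟩)

theorem differentiableAt_invJet {x : Fin 3 → ℂ} (hx : x 0 ≠ 0) : DifferentiableAt ℂ invJet x := by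
  simp only [invJet, differentiableAt_pi, Fin.forall_fin_succ, Matrix.cons_val_zero,
    Matrix.cons_val_succ, IsEmpty.forall_iff, and_true]
  refine ⟨?_, ?_, ?_⟩ <;> fun_prop (disch := simpa using hx)

theorem differentiableAt_logJet {x : Fin 3 → ℂ} (hx : x 0 ≠ 0) : DifferentiableAt ℂ logJet x := by
  simp only [logJet, differentiableAt_pi, Fin.forall_fin_succ, Matrix.cons_val_zero,
    Matrix.cons_val_succ, IsEmpty.forall_iff, and_true]
  refine ⟨?_, ?_⟩ <;> fun_prop (disch := simpa using hx)

theorem differentiableAt_normalize (hp : p ∈ domain d χ) :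
    DifferentiableAt ℂ (normalize d χ) p := by
  have hl : DifferentiableAt ℂ (fun q : Amb d => invJet fun k => q.1 k χ.1) p :=
    DifferentiableAt.comp (f := fun (q : Amb d) k => q.1 k χ.1) p (differentiableAt_invJet hp.1)
      (by fun_prop)
  have hz : Differentiable ℂ fun x : (Fin 3 → ℂ) × Jet => scaleJet x.1 x.2 :=
    IsPolyMap.differentiable (by fun_prop)
  have hlog : DifferentiableAt ℂ (fun q : Amb d => logJet (invJet fun k => q.1 k χ.1)) p :=
    DifferentiableAt.comp p (differentiableAt_logJet (invJet_ne _ hp.1)) hl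
  have ha (c : Fin 2) : DifferentiableAt ℂ (fun q : Amb d => (q.2.1 c (χ.2 c))⁻¹) p :=
    DifferentiableAt.fun_inv (by fun_prop) (hp.2 c)
  refine DifferentiableAt.prodMk ?_ (DifferentiableAt.prodMk (differentiableAt_pi.2 fun c => ?_)
    (differentiableAt_pi.2 fun c => ?_))
  · exact DifferentiableAt.comp (f := fun q : Amb d => (invJet fun k => q.1 k χ.1, q.1)) p
      (hz _) (hl.prodMk (by fun_prop))
  · exact (ha c).fun_smul (by fun_prop)
  · exact DifferentiableAt.add (by fun_prop) (hlog.fun_const_smul _)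

/-- The linear part of the affine map `act d l μ`. -/
def actLin (d : Fin 2 → ℕ) (l : Fin 3 → ℂ) (μ : Fin 2 → ℂ) : Amb d →ₗ[ℂ] Amb d where
  toFun w := (scaleJet l w.1, fun c => μ c • w.2.1 c, w.2.2)
  map_add' v w := by
    refine Prod.ext (funext fun k => ?_) (by ext <;> simp [mul_add])
    fin_cases k <;> simp [scaleJet] <;> module
  map_smul' r w := by
    refine Prod.ext (funext fun k => ?_) (by ext <;> simp [mul_left_comm])
    fin_cases k <;> simp [scaleJet] <;> module

theorem act_add (l : Fin 3 → ℂ) (μ : Fin 2 → ℂ) (p w : Amb d) :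
    act d l μ (p + w) = act d l μ p + actLin d l μ w := by
  have h := (actLin d l μ).map_add p w
  simp only [actLin, LinearMap.coe_mk, AddHom.coe_mk, Prod.mk_add_mk, Prod.mk.injEq] at h
  refine Prod.ext h.1 (Prod.ext h.2.1 (funext fun c => ?_))
  simp [act, actLin, add_right_comm]

/-- The derivative of `act d l μ p` at `l = 1`, `μ = 1`. -/
def infAct (d : Fin 2 → ℕ) (l : Fin 3 → ℂ) (ν : Fin 2 → ℂ) (p : Amb d) : Amb d :=
  (scaleJet l p.1, fun c => ν c • p.2.1 c, fun c => (d c : ℂ) • ![l 1, l 2])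

theorem hasDerivAt_act (l : Fin 3 → ℂ) (ν : Fin 2 → ℂ) (p : Amb d) :
    HasDerivAt (fun t : ℂ => act d (oneJet + t • l) (1 + t • ν) p) (infAct d l ν p) 0 := by
  have hz : (fun t : ℂ => scaleJet (oneJet + t • l) p.1) = fun t => p.1 + t • scaleJet l p.1 := by
    funext t k
    fin_cases k <;> simp [scaleJet, oneJet] <;> module
  have hlog : HasDerivAt (fun t : ℂ => logJet (oneJet + t • l)) ![l 1, l 2] 0 := by
    have h (k : Fin 3) : HasDerivAt (fun t : ℂ => oneJet k + t * l k) (l k) 0 :=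
      hasDerivAt_line (oneJet k) (l k)
    have h₁ := (h 1).div (h 0) (by simp [oneJet])
    have h₂ := ((h 2).div (h 0) (by simp [oneJet])).sub (h₁.pow 2)
    refine hasDerivAt_pi.2 (Fin.forall_fin_two.2 ⟨h₁.congr_deriv ?_, h₂.congr_deriv ?_⟩) <;>
    simp [oneJet]
  refine HasDerivAt.prodMk (hz ▸ hasDerivAt_line _ _) (HasDerivAt.prodMk
    (hasDerivAt_pi.2 fun c => ?_) (hasDerivAt_pi.2 fun c => ?_))
  · simpa [add_smul, smul_smul] using hasDerivAt_line (p.2.1 c) (ν c • p.2.1 c)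
  · exact (hlog.const_smul (d c : ℂ)).const_add _

theorem act_one_add_zero_smul (l : Fin 3 → ℂ) (ν : Fin 2 → ℂ) (p : Amb d) :
    act d (oneJet + (0 : ℂ) • l) (1 + (0 : ℂ) • ν) p = p := by
  simp only [zero_smul, add_zero, act_one]

theorem eventually_one_add_smul_ne_zero (l : Fin 3 → ℂ) (ν : Fin 2 → ℂ) :
    ∀ᶠ t : ℂ in nhds 0, (oneJet + t • l) 0 ≠ 0 ∧ ∀ c, (1 + t • ν) c ≠ 0 := by
  refine Filter.Eventually.and ?_ (Filter.eventually_all.2 fun c => ?_) <;>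
  refine ContinuousAt.eventually_ne (by fun_prop) ?_ <;> simp [oneJet]

theorem infAct_mem_coneTangent (hp : p ∈ cone d) (l : Fin 3 → ℂ) (ν : Fin 2 → ℂ) :
    infAct d l ν p ∈ coneTangent d p := by
  have orbit {f : Amb d → ℂ} (hf : Differentiable ℂ f) (h : ∀ q ∈ cone d, f q = 0) :
      fderiv ℂ f p (infAct d l ν p) = 0 := by
    refine ((hf p).hasFDerivAt.comp_hasDerivAt_of_eq 0 (hasDerivAt_act l ν p)
      (act_one_add_zero_smul l ν p).symm).unique
      ((hasDerivAt_const (0 : ℂ) (0 : ℂ)).congr_of_eventuallyEq ?_)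
    filter_upwards [eventually_one_add_smul_ne_zero l ν] with t ht
    exact h _ (act_mem_cone ht.1 ht.2 hp)
  exact fun c => ⟨orbit differentiable_eqOne fun q hq => (hq.2.2 c).1,
    orbit differentiable_eqTwo fun q hq => (hq.2.2 c).2⟩

theorem fderiv_normalize_infAct (hp : p ∈ domain d χ) (l : Fin 3 → ℂ) (ν : Fin 2 → ℂ) :
    fderiv ℂ (normalize d χ) p (infAct d l ν p) = 0 := by
  refine ((differentiableAt_normalize hp).hasFDerivAt.comp_hasDerivAt_of_eq 0
    (hasDerivAt_act l ν p) (act_one_add_zero_smul l ν p).symm).unique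
    ((hasDerivAt_const 0 (normalize d χ p)).congr_of_eventuallyEq ?_)
  filter_upwards [eventually_one_add_smul_ne_zero l ν] with t ht
  exact normalize_act ht.1 ht.2 hp

theorem fderiv_normalize_actLin (hl : l 0 ≠ 0) (hμ : ∀ c, μ c ≠ 0) (hp : p ∈ domain d χ)
    (w : Amb d) :
    fderiv ℂ (normalize d χ) (act d l μ p) (actLin d l μ w) = fderiv ℂ (normalize d χ) p w := by
  have hact : HasDerivAt (fun t : ℂ => act d l μ (p + t • w)) (actLin d l μ w) 0 := by
    simp only [act_add, map_smul]
    exact hasDerivAt_line _ _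
  have hdiff := differentiableAt_normalize (act_mem_domain hl hμ hp)
  refine (hdiff.hasFDerivAt.comp_hasDerivAt_of_eq 0 hact (by simp)).unique ?_
  refine ((differentiableAt_normalize hp).hasFDerivAt.comp_hasDerivAt_of_eq 0
    (hasDerivAt_line p w) (by simp)).congr_of_eventuallyEq ?_
  have near : ∀ᶠ t : ℂ in nhds 0, p + t • w ∈ domain d χ :=
    (hasDerivAt_line p w).continuousAt.eventually_mem
      ((isOpen_domain χ).mem_nhds (by simpa using hp))
  filter_upwards [near] with t ht
  exact normalize_act hl hμ ht

/-- The projection of a vector onto the tangent space of the chart `χ` along the tangent space of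
the orbit of `p`. -/
def chartProj (d : Fin 2 → ℕ) (χ : Chart d) (p w : Amb d) : Amb d :=
  w - infAct d (fun k => w.1 k χ.1) (fun c => w.2.1 c (χ.2 c)) p

theorem IsPolyMap.chartProj {W : Amb d → Amb d} (hW : IsPolyMap W) (χ : Chart d) :
    IsPolyMap fun p => chartProj d χ p (W p) := by
  unfold LogJets.chartProj infAct
  fun_prop

theorem scaleJet_apply_chart {i : Fin 3} {z : Jet} (hz : (fun k => z k i) = oneJet)
    (l : Fin 3 → ℂ) (k : Fin 3) : scaleJet l z k i = l k := by
  have h := polyJet_X_scaleJet l z i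
  rw [polyJet_X, polyJet_X, hz, mulJet_comm, oneJet_mulJet] at h
  exact congrFun h k

theorem chartProj_apply_chart (hp : p ∈ slice d χ) (w : Amb d) :
    (∀ k, (chartProj d χ p w).1 k χ.1 = 0) ∧ ∀ c, (chartProj d χ p w).2.1 c (χ.2 c) = 0 :=
  ⟨fun k => sub_eq_zero.2
      (scaleJet_apply_chart (coord_eq_oneJet hp) (fun k => w.1 k χ.1) k).symm,
    fun c => by simp [chartProj, infAct, hp.2.2.2.2 c]⟩

theorem chartProj_mem_tangentSpace (hp : p ∈ slice d χ) {w : Amb d} (hw : w ∈ coneTangent d p) :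
    chartProj d χ p w ∈ tangentSpace d χ p :=
  ⟨(chartProj_apply_chart hp w).1, (chartProj_apply_chart hp w).2,
    Submodule.sub_mem _ hw (infAct_mem_coneTangent hp.1 _ _)⟩

theorem chartProj_eq_self {w : Amb d} (hw : w ∈ tangentSpace d χ p) : chartProj d χ p w = w := by
  have h : infAct d 0 0 p = 0 := by
    refine Prod.ext (funext fun k => ?_) (Prod.ext (funext fun c => ?_) (funext₂ fun c j => ?_))
    · fin_cases k <;> simp [infAct, scaleJet]
    · simp [infAct]
    · fin_cases j <;> simp [infAct]
  rw [chartProj, funext hw.1, funext hw.2.1]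
  exact sub_eq_self.2 h

theorem fderiv_normalize (hp : p ∈ slice d χ) (w : Amb d) :
    fderiv ℂ (normalize d χ) p w = chartProj d χ p w := by
  have hpd := slice_subset_domain hp
  set w' := chartProj d χ p w with hw'
  obtain ⟨hz, ha⟩ := chartProj_apply_chart hp w
  have h : fderiv ℂ (normalize d χ) p w' = w' := by
    refine ((differentiableAt_normalize hpd).hasFDerivAt.comp_hasDerivAt_of_eq 0
      (hasDerivAt_line p w') (by simp)).unique
      ((hasDerivAt_line p w').congr_of_eventuallyEq (Filter.Eventually.of_forall fun t => ?_))
    refine normalize_eq_self ?_ fun c => ?_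
    · rw [← coord_eq_oneJet hp]
      simp [hw', hz]
    · simp [hw', ha, hp.2.2.2.2 c]
  rw [← h, hw', chartProj, map_sub, fderiv_normalize_infAct hpd, sub_zero]

end Charts

/-! ### Equivariant vector fields on the cone -/

section Equivariant

variable {d : Fin 2 → ℕ} {e e' : ℕ} {m m' : Fin 2 → ℕ} {χ : Chart d} {p : Amb d} {c : Fin 2}

/-- The polynomial vector fields on the space of homogeneous coordinates which are tangent to the
cone and of weight `(e, m)` for the changes of homogeneous coordinates; they descend to sections of
`T ⊗ 𝒪_{ℙ²}(e) ⊗ 𝒪_{ℙ^{N_{d₁}}}(m₁) ⊗ 𝒪_{ℙ^{N_{d₂}}}(m₂)`. -/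
def equivariantFields (d : Fin 2 → ℕ) (e : ℕ) (m : Fin 2 → ℕ) : Submodule ℂ (Amb d → Amb d) where
  carrier := {W | IsPolyMap W ∧ (∀ p ∈ cone d, W p ∈ coneTangent d p) ∧
    ∀ (l : Fin 3 → ℂ) (μ : Fin 2 → ℂ) (p : Amb d), l 0 ≠ 0 → (∀ c, μ c ≠ 0) →
      W (act d l μ p) = (l 0 ^ e * ∏ c, μ c ^ m c) • actLin d l μ (W p)}
  add_mem' := by
    rintro V W ⟨hV, hVt, hVe⟩ ⟨hW, hWt, hWe⟩
    exact ⟨hV.add hW, fun p hp => add_mem (hVt p hp) (hWt p hp), fun l μ p hl hμ => by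
      simp only [Pi.add_apply, hVe l μ p hl hμ, hWe l μ p hl hμ, map_add, smul_add]⟩
  zero_mem' := ⟨isPolyMap_const 0, fun p _ => zero_mem _, fun l μ p _ _ => by simp⟩
  smul_mem' := by
    rintro r W ⟨hW, hWt, hWe⟩
    exact ⟨(isPolyMap_const r).fun_smul hW, fun p hp => Submodule.smul_mem _ r (hWt p hp),
      fun l μ p hl hμ => by
        simp only [Pi.smul_apply, hWe l μ p hl hμ, map_smul, smul_comm r]⟩

theorem smul_mem_equivariantFields {f : Amb d → ℂ} (hf : IsPolyMap f)
    (hfe : ∀ (l : Fin 3 → ℂ) (μ : Fin 2 → ℂ) (p : Amb d),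
      f (act d l μ p) = (l 0 ^ e * ∏ c, μ c ^ m c) * f p)
    {W : Amb d → Amb d} (hW : W ∈ equivariantFields d e' m') :
    (fun p => f p • W p) ∈ equivariantFields d (e + e') (m + m') := by
  refine ⟨hf.fun_smul hW.1, fun p hp => Submodule.smul_mem _ _ (hW.2.1 p hp),
    fun l μ p hl hμ => ?_⟩
  simp only [hfe, hW.2.2 l μ p hl hμ, map_smul, smul_smul, Pi.add_apply, pow_add,
    Finset.prod_mul_distrib]
  congr 1
  ring

/-- The section defined by an equivariant vector field. -/
def toTwistedVectorField {W : Amb d → Amb d} (hW : W ∈ equivariantFields d e m) :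
    TwistedVectorField d e m where
  toFun χ p := chartProj d χ p (W p)
  regular χ φ := ⟨_, isPolyMap_iff_mem_polyFun.1 ((hW.1.chartProj χ).map φ), fun _ _ => rfl⟩
  tangent χ p hp := chartProj_mem_tangentSpace hp (hW.2.1 p hp.1)
  compat χ χ' p hp hp' := by
    have hl : invJet (fun k => p.1 k χ'.1) 0 ≠ 0 := invJet_ne _ hp'.1
    have hμ (c : Fin 2) : (p.2.1 c (χ'.2 c))⁻¹ ≠ 0 := inv_ne_zero (hp'.2 c)
    have cancel : p.1 0 χ'.1 ^ e * (∏ c, p.2.1 c (χ'.2 c) ^ m c) *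
        (invJet (fun k => p.1 k χ'.1) 0 ^ e * ∏ c, (p.2.1 c (χ'.2 c))⁻¹ ^ m c) = 1 := by
      rw [mul_mul_mul_comm, ← mul_pow, ← Finset.prod_mul_distrib]
      simp [invJet, hp'.1, hp'.2]
    rw [chartProj, map_sub, fderiv_normalize_infAct hp', sub_zero,
      ← fderiv_normalize (normalize_mem_slice hp.1 hp'), normalize, hW.2.2 _ _ p hl hμ, map_smul,
      fderiv_normalize_actLin hl hμ hp', smul_smul, cancel, one_smul]

/-- The values at `p` of the vector fields of weight `(e, m)`. -/
def fieldValues (d : Fin 2 → ℕ) (e : ℕ) (m : Fin 2 → ℕ) (p : Amb d) : Submodule ℂ (Amb d) :=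
  (equivariantFields d e m).map (LinearMap.proj p)

theorem apply_mem_fieldValues {W : Amb d → Amb d} (hW : W ∈ equivariantFields d e m) (p : Amb d) :
    W p ∈ fieldValues d e m p :=
  ⟨W, hW, rfl⟩

theorem fieldValues_le_coneTangent (hp : p ∈ cone d) : fieldValues d e m p ≤ coneTangent d p := by
  rintro _ ⟨W, hW, rfl⟩
  exact hW.2.1 p hp

theorem fieldValues_mono (hp : p ∈ slice d χ) (he : e ≤ e') (hm : m ≤ m') :
    fieldValues d e m p ≤ fieldValues d e' m' p := by
  rintro _ ⟨W, hW, rfl⟩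
  have h := smul_mem_equivariantFields (e := e' - e) (m := m' - m)
    (f := fun p => p.1 0 χ.1 ^ (e' - e) * ∏ c, p.2.1 c (χ.2 c) ^ (m' - m) c) (by fun_prop)
    (fun l μ p => ?_) hW
  · rw [tsub_add_cancel_of_le he, tsub_add_cancel_of_le hm] at h
    simpa [hp.2.1, hp.2.2.2.2] using apply_mem_fieldValues h p
  · simp only [act, scaleJet, Matrix.cons_val_zero, Pi.smul_apply, smul_eq_mul, mul_pow,
      Finset.prod_mul_distrib]
    ring

theorem generatedAt_of_coneTangent_le {x : LogJetSpace d}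
    (h : ∀ (χ : Chart d) (p : Amb d) (hp : p ∈ slice d χ), Quotient.mk _ ⟨p, hp.1⟩ = x →
      coneTangent d p ≤ fieldValues d e m p) : GeneratedAt d e m x := by
  intro χ p hp hx v hv
  obtain ⟨W, hW, rfl⟩ := h χ p hp hx hv.2.2
  exact ⟨toTwistedVectorField hW, chartProj_eq_self hv⟩

/-- The vector field on the cone induced by a linear vector field on `ℂ³`: the coefficients move so
that the sections `s_c` stay constant along the curve. -/
def linearLift (d : Fin 2 → ℕ) (M : Matrix (Fin 3) (Fin 3) ℂ) (p : Amb d) : Amb d :=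
  (fun k => M.mulVec (p.1 k), fun c => -coefs (d c) (linearField M (form (p.2.1 c))), 0)

theorem isHomogeneous_linearField_form (M : Matrix (Fin 3) (Fin 3) ℂ) {n : ℕ} (a : Mon n → ℂ) :
    (linearField M (form a)).IsHomogeneous n := by
  have ha := isHomogeneous_form a
  cases n with
  | zero =>
    rw [totalDegree_eq_zero_iff_eq_C.1 ((totalDegree_zero_iff_isHomogeneous _).2 ha),
      linearField, derivation_C]
    exact isHomogeneous_zero _ _ _
  | succ n => exact isHomogeneous_linearField M ha

theorem linearLift_mem_equivariantFields (M : Matrix (Fin 3) (Fin 3) ℂ) :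
    linearLift d M ∈ equivariantFields d 0 0 := by
  refine ⟨?_, fun p _ => mem_coneTangent_iff.2 fun c => ?_, fun l μ p _ _ => ?_⟩
  · have h (c : Fin 2) :
        IsPolyMap fun p : Amb d => -coefs (d c) (linearField M (form (p.2.1 c))) :=
      IsPolyMap.map (g := fun p : Amb d => p.2.1 c) (by fun_prop)
        (-(coefs (d c) ∘ₗ (linearField M).toLinearMap ∘ₗ formLin (d c)))
    have h' (k : Fin 3) : IsPolyMap fun p : Amb d => M.mulVec (p.1 k) :=
      IsPolyMap.map (g := fun p : Amb d => p.1 k) (by fun_prop) M.mulVecLin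
    unfold linearLift
    fun_prop
  · have hform : form ((linearLift d M p).2.1 c) = -linearField M (form (p.2.1 c)) := by
      rw [← form_coefs (isHomogeneous_linearField_form M (p.2.1 c))]
      exact (formLin (d c)).map_neg _
    have hδ : fderiv ℂ (sectionJet d c) p (linearLift d M p) = 0 := by
      rw [fderiv_sectionJet rfl, hform, add_neg_cancel, map_zero]
    rw [hδ]
    funext k
    fin_cases k <;> simp [mulJet, linearLift]
  · simp only [pow_zero, Pi.zero_apply, Finset.prod_const_one, mul_one, one_smul]
    refine Prod.ext (funext fun k => ?_) (Prod.ext (funext fun c => ?_) rfl)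
    · fin_cases k <;>
        simp [linearLift, act, actLin, scaleJet, Matrix.mulVec_add, Matrix.mulVec_smul]
    · simp [linearLift, act, actLin, form_smul]

/-- The tangent vector which moves the coefficients of the component `c` by `b` and its logarithmic
coordinates by `θ`. -/
def verticalVector (d : Fin 2 → ℕ) (c : Fin 2) (b : Mon (d c) → ℂ) (θ : Fin 2 → ℂ) : Amb d :=
  (0, Pi.single c b, Pi.single c θ)

theorem smul_verticalVector (x : ℂ) (b : Mon (d c) → ℂ) (θ : Fin 2 → ℂ) :
    x • verticalVector d c b θ = verticalVector d c (x • b) (x • θ) := by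
  simp [verticalVector, Pi.single_smul]

theorem actLin_verticalVector (l : Fin 3 → ℂ) (μ : Fin 2 → ℂ) (b : Mon (d c) → ℂ)
    (θ : Fin 2 → ℂ) :
    actLin d l μ (verticalVector d c b θ) = verticalVector d c (μ c • b) θ := by
  refine Prod.ext (funext fun k => ?_) (Prod.ext (funext fun c' => ?_) rfl)
  · fin_cases k <;> simp [actLin, verticalVector, scaleJet]
  · rcases eq_or_ne c' c with rfl | hc <;> simp [actLin, verticalVector, *]

theorem IsPolyMap.verticalVector {b : Amb d → Mon (d c) → ℂ} (hb : IsPolyMap b)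
    {θ : Amb d → Fin 2 → ℂ} (hθ : IsPolyMap θ) :
    IsPolyMap fun p => verticalVector d c (b p) (θ p) :=
  (isPolyMap_const 0).prodMk ((hb.map (LinearMap.single ℂ (fun c => Mon (d c) → ℂ) c)).prodMk
    (hθ.map (LinearMap.single ℂ (fun _ => Fin 2 → ℂ) c)))

/-- Here `r` is the 2-jet of `F / s_c`, the derivative of `log s_c` in the direction `F`. -/
theorem verticalVector_mem_coneTangent (hp : p ∈ cone d) {F : MvPolynomial (Fin 3) ℂ}
    (hF : F.IsHomogeneous (d c)) {r : Fin 3 → ℂ}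
    (h : polyJet p.1 F = mulJet (sectionJet d c p) r) :
    verticalVector d c (coefs (d c) F) (Fin.tail r) ∈ coneTangent d p := by
  refine mem_coneTangent_iff.2 fun c' => ?_
  rw [fderiv_sectionJet_of_vertical rfl, verticalVector]
  rcases eq_or_ne c' c with rfl | hc
  · simp only [Pi.single_eq_same, form_coefs hF, h]
    rw [sectionJet_eq hp c', smul_mulJet, ← mulJet_smul]
    congr 1
    funext k
    fin_cases k <;> simp [mulJet, Fin.tail, expJet]
  · simp only [Pi.single_eq_of_ne hc, form_zero, map_zero]
    funext k
    fin_cases k <;> simp [mulJet]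

theorem verticalVector_mem_equivariantFields {B : Amb d → MvPolynomial (Fin 3) ℂ}
    {r : Amb d → Fin 3 → ℂ} (hB : IsPolyMap B) (hr : IsPolyMap r)
    (hom : ∀ p, (B p).IsHomogeneous (d c))
    (hjet : ∀ p ∈ cone d, polyJet p.1 (B p) = mulJet (sectionJet d c p) (r p))
    (hBe : ∀ (l : Fin 3 → ℂ) (μ : Fin 2 → ℂ) (p : Amb d),
      B (act d l μ p) = (l 0 ^ e * μ c) • B p)
    (hre : ∀ (l : Fin 3 → ℂ) (μ : Fin 2 → ℂ) (p : Amb d), l 0 ≠ 0 →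
      r (act d l μ p) = l 0 ^ e • r p) :
    (fun p => verticalVector d c (coefs (d c) (B p)) (Fin.tail (r p))) ∈
      equivariantFields d e 0 := by
  have tail : IsPolyMap fun p => Fin.tail (r p) :=
    isPolyMap_pi fun k => hr.map (LinearMap.proj k.succ)
  refine ⟨hB.coefs.verticalVector tail,
    fun p hp => verticalVector_mem_coneTangent hp (hom p) (hjet p hp), fun l μ p hl _ => ?_⟩
  simp only [actLin_verticalVector, smul_verticalVector, hBe, hre l μ p hl, map_smul, Pi.zero_apply,
    pow_zero, Finset.prod_const_one, mul_one, smul_smul]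
  rfl

/-- The 2-jet of the linear form `minorForm (z 0) k j` along the curve. -/
def minorJet (k j : Fin 3) (z : Jet) : Fin 3 → ℂ := polyJet z (minorForm (z 0) k j)

@[fun_prop]
theorem isPolyMap_minorJet (k j : Fin 3) : IsPolyMap (minorJet k j) := by
  unfold minorJet
  fun_prop

theorem minorJet_apply_zero (k j : Fin 3) (z : Jet) : minorJet k j z 0 = 0 := by
  simp [minorJet, minorForm, polyJet_X, mul_comm]

theorem minorForm_act (l : Fin 3 → ℂ) (μ : Fin 2 → ℂ) (p : Amb d) (k j : Fin 3) :
    minorForm ((act d l μ p).1 0) k j = l 0 • minorForm (p.1 0) k j :=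
  minorForm_smul (l 0) (p.1 0) k j

theorem polar_act (l : Fin 3 → ℂ) (μ : Fin 2 → ℂ) (p : Amb d) (F : MvPolynomial (Fin 3) ℂ) :
    polar ((act d l μ p).1 0) F = l 0 • polar (p.1 0) F :=
  polar_smul (l 0) (p.1 0) F

theorem minorJet_act (l : Fin 3 → ℂ) (μ : Fin 2 → ℂ) (p : Amb d) (k j : Fin 3) :
    minorJet k j (act d l μ p).1 = l 0 • mulJet l (minorJet k j p.1) := by
  rw [minorJet, minorForm_act]
  simp only [act, minorForm, map_smul, polyJet_X_scaleJet, minorJet, sub_eq_add_neg,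
    mulJet_add, mulJet_smul, map_add, ← neg_one_smul ℂ (p.1 0 j • _)]

theorem euler_mem_equivariantFields (c : Fin 2) :
    (fun p : Amb d => verticalVector d c (p.2.1 c) 0) ∈ equivariantFields d 0 0 := by
  have h := verticalVector_mem_equivariantFields (d := d) (c := c) (e := 0)
    (B := fun p => form (p.2.1 c)) (r := fun _ => oneJet) (by fun_prop) (by fun_prop)
    (fun p => isHomogeneous_form _) (fun p _ => by rw [mulJet_comm, oneJet_mulJet, sectionJet])
    (fun l μ p => by simp [act, form_smul]) (fun _ _ _ _ => by simp)
  have tail_oneJet : Fin.tail oneJet = 0 := by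
    funext k
    fin_cases k <;> rfl
  simpa only [coefs_form, tail_oneJet] using h

theorem polarField_mem_equivariantFields {n : ℕ} (hn : d c = n + 1) (k j : Fin 3) :
    (fun p => verticalVector d c
      (coefs (d c) (minorForm (p.1 0) k j * polar (p.1 0) (form (p.2.1 c))))
      ![d c * minorJet k j p.1 1,
        d c * minorJet k j p.1 2 - 2 * p.2.2 c 0 * minorJet k j p.1 1]) ∈
      equivariantFields d 2 0 := by
  have hom (p : Amb d) : (form (p.2.1 c)).IsHomogeneous (n + 1) := hn ▸ isHomogeneous_form _
  refine verticalVector_mem_equivariantFields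
    (r := fun p => ![0, d c * minorJet k j p.1 1,
      d c * minorJet k j p.1 2 - 2 * p.2.2 c 0 * minorJet k j p.1 1])
    (by fun_prop) (by fun_prop) (fun p => ?_)
    (fun p hp => ?_) (fun l μ p => ?_) fun l μ p hl => ?_
  · have h := (isHomogeneous_minorForm (p.1 0) k j).mul (isHomogeneous_polar (p.1 0) (hom p))
    rwa [show 1 + n = d c by omega] at h
  · have h₀ := polyJet_polar_apply_zero p.1 (hom p)
    have h₁ := polyJet_polar_apply_one p.1 (hom p)
    rw [polyJet_mul, ← minorJet]
    rw [← sectionJet, sectionJet_eq hp] at h₀ h₁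
    rw [sectionJet_eq hp]
    funext i
    fin_cases i <;> simp [mulJet, minorJet_apply_zero, h₀, h₁, expJet, hn] <;> ring
  · simp only [minorForm_act, polar_act]
    simp only [act, form_smul, Derivation.map_smul, smul_mul_assoc, mul_smul_comm, smul_smul]
    congr 1
    ring
  · simp only [minorJet_act]
    funext i
    fin_cases i <;> simp [mulJet, minorJet_apply_zero, act, logJet, Matrix.vecHead]
    · field_simp
    · field_simp
      ring

theorem polarPolarField_mem_equivariantFields {n : ℕ} (hn : d c = n + 2) (k i j : Fin 3) :
    (fun p => verticalVector d c
      (coefs (d c) (minorForm (p.1 0) k i * minorForm (p.1 0) k j *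
        polar (p.1 0) (polar (p.1 0) (form (p.2.1 c)))))
      ![0, 2 * (n + 1) * (n + 2) * (minorJet k i p.1 1 * minorJet k j p.1 1)]) ∈
      equivariantFields d 4 0 := by
  have hom (p : Amb d) : (form (p.2.1 c)).IsHomogeneous (n + 1 + 1) := hn ▸ isHomogeneous_form _
  refine verticalVector_mem_equivariantFields
    (r := fun p => ![0, 0, 2 * (n + 1) * (n + 2) * (minorJet k i p.1 1 * minorJet k j p.1 1)])
    (by fun_prop) (by fun_prop) (fun p => ?_)
    (fun p _ => ?_) (fun l μ p => ?_) fun l μ p _ => ?_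
  · have h := ((isHomogeneous_minorForm (p.1 0) k i).mul
      (isHomogeneous_minorForm (p.1 0) k j)).mul
      (isHomogeneous_polar (p.1 0) (isHomogeneous_polar (p.1 0) (hom p)))
    rwa [show 1 + 1 + n = d c by omega] at h
  · have h₀ := polyJet_polar_apply_zero p.1 (isHomogeneous_polar (p.1 0) (hom p))
    rw [polyJet_polar_apply_zero p.1 (hom p), ← sectionJet] at h₀
    rw [polyJet_mul, polyJet_mul, ← minorJet, ← minorJet]
    funext a
    fin_cases a <;> simp [mulJet, minorJet_apply_zero, h₀]
    ring
  · simp only [minorForm_act, polar_act]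
    simp only [act, form_smul, Derivation.map_smul, smul_mul_assoc, mul_smul_comm, smul_smul]
    congr 1
    ring
  · simp only [minorJet_act]
    funext a
    fin_cases a <;> simp [mulJet, minorJet_apply_zero]
    ring

theorem cubicField_mem_equivariantFields {n : ℕ} (hn : d c = n + 3) (γ : Mon (d c))
    (k i j l : Fin 3) {G : MvPolynomial (Fin 3) ℂ} (hG : G.IsHomogeneous n) :
    (fun p => verticalVector d c (coefs (d c) (p.2.1 c γ •
      (minorForm (p.1 0) k i * minorForm (p.1 0) k j * minorForm (p.1 0) k l * G))) 0) ∈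
      equivariantFields d 3 0 := by
  refine verticalVector_mem_equivariantFields (r := fun _ => 0) (by fun_prop) (by fun_prop)
    (fun p => (homogeneousSubmodule _ ℂ _).smul_mem _ ?_) (fun p _ => ?_) (fun t μ p => ?_)
    fun _ _ _ _ => by simp
  · rw [hn, add_comm]
    exact (((isHomogeneous_minorForm _ k i).mul (isHomogeneous_minorForm _ k j)).mul
      (isHomogeneous_minorForm _ k l)).mul hG
  · rw [map_smul, polyJet_mul, polyJet_mul, polyJet_mul, ← minorJet, ← minorJet, ← minorJet]
    funext a
    fin_cases a <;> simp [mulJet, minorJet_apply_zero]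
  · simp only [minorForm_act]
    simp only [act, Pi.smul_apply, smul_eq_mul, smul_mul_assoc, mul_smul_comm, smul_smul]
    congr 1
    ring

end Equivariant

/-! ### Generation at the jets with non-zero Wronskian -/

theorem exists_mulVec_eq_of_det_ne_zero {n K : Type*} [Fintype n] [DecidableEq n] [Field K]
    {z : n → n → K} (hz : (Matrix.of z).det ≠ 0) (v : n → n → K) :
    ∃ M : Matrix n n K, ∀ k, M.mulVec (z k) = v k := by
  have hu : IsUnit (Matrix.of z).transpose.det := by simpa using hz
  refine ⟨(Matrix.of v).transpose * (Matrix.of z).transpose⁻¹, fun k => ?_⟩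
  have hzk : z k = (Matrix.of z).transpose.mulVec (Pi.single k 1) := by
    funext i
    simp
  rw [hzk, Matrix.mulVec_mulVec, Matrix.mul_assoc, Matrix.nonsing_inv_mul _ hu, Matrix.mul_one]
  funext i
  simp

section Generation

variable {d : Fin 2 → ℕ} {χ : Chart d} {p : Amb d} {c : Fin 2}

/-- The forms `F` such that moving the coefficients of the component `c` by those of `F` is the
value at `p` of a vector field of weight `(e, 0)`, up to the logarithmic coordinates. -/
def verticalForms (d : Fin 2 → ℕ) (e : ℕ) (c : Fin 2) (p : Amb d) :
    Submodule ℂ (MvPolynomial (Fin 3) ℂ) where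
  carrier := {F | ∃ θ, verticalVector d c (coefs (d c) F) θ ∈ fieldValues d e 0 p}
  add_mem' := by
    rintro F G ⟨θ, hF⟩ ⟨θ', hG⟩
    refine ⟨θ + θ', ?_⟩
    simpa [verticalVector, Pi.single_add] using add_mem hF hG
  zero_mem' := ⟨0, by
    simp only [verticalVector, map_zero, Pi.single_zero]
    exact zero_mem _⟩
  smul_mem' := by
    rintro r F ⟨θ, hF⟩
    refine ⟨r • θ, ?_⟩
    rw [map_smul, ← smul_verticalVector]
    exact Submodule.smul_mem _ r hF

theorem mem_verticalForms_of_isHomogeneous (hp : p ∈ slice d χ) (hs : sectionJet d c p 0 ≠ 0)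
    {F : MvPolynomial (Fin 3) ℂ} (hF : F.IsHomogeneous (d c)) : F ∈ verticalForms d 4 c p := by
  have hk : p.1 0 χ.1 ≠ 0 := by simp [hp.2.1]
  refine mem_of_polar_mem (S := verticalForms d 4 c p) hk (isHomogeneous_form (p.2.1 c)) hs
    ⟨0, ?_⟩
    (fun n hn j => ⟨_, fieldValues_mono hp (by norm_num) le_rfl
      (apply_mem_fieldValues (polarField_mem_equivariantFields hn χ.1 j) p)⟩)
    (fun n hn i j =>
      ⟨_, apply_mem_fieldValues (polarPolarField_mem_equivariantFields hn χ.1 i j) p⟩)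
    (fun n hn i j l G hG => ⟨0, ?_⟩) hF
  · rw [coefs_form]
    exact fieldValues_mono hp (by norm_num) le_rfl
      (apply_mem_fieldValues (euler_mem_equivariantFields c) p)
  · simpa only [hp.2.2.2.2 c, one_smul] using fieldValues_mono hp (Nat.le_succ 3) le_rfl
      (apply_mem_fieldValues (cubicField_mem_equivariantFields hn (χ.2 c) χ.1 i j l hG) p)

theorem coneTangent_le_fieldValues (hp : p ∈ slice d χ) (hs : ∀ c, sectionJet d c p 0 ≠ 0)
    (hdet : (Matrix.of p.1).det ≠ 0) {e : ℕ} (he : 4 ≤ e) (m : Fin 2 → ℕ) :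
    coneTangent d p ≤ fieldValues d e m p := by
  intro v hv
  refine fieldValues_mono hp he (fun c => Nat.zero_le (m c)) ?_
  obtain ⟨M, hM⟩ := exists_mulVec_eq_of_det_ne_zero hdet v.1
  set b := fun c => v.2.1 c - (linearLift d M p).2.1 c with b_def
  choose θ hθ using fun c =>
    mem_verticalForms_of_isHomogeneous hp (hs c) (isHomogeneous_form (b c))
  simp only [coefs_form] at hθ
  set w := linearLift d M p + ∑ c, verticalVector d c (b c) (θ c) with w_def
  have hw : w ∈ fieldValues d 4 0 p :=
    add_mem (fieldValues_mono hp (Nat.zero_le 4) le_rfl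
      (apply_mem_fieldValues (linearLift_mem_equivariantFields M) p))
      (sum_mem fun c _ => hθ c)
  have z_eq : (v - w).1 = 0 := by
    funext k
    simp [w_def, verticalVector, linearLift, hM]
  have a_eq : (v - w).2.1 = 0 := by
    funext c
    fin_cases c <;> simp [w_def, b_def, verticalVector]
  have hvw : v - w = 0 :=
    eq_zero_of_mem_coneTangent hs (sub_mem hv (fieldValues_le_coneTangent hp.1 hw)) z_eq a_eq
  rwa [sub_eq_zero.1 hvw]

end Generation

/-! ### The exceptional set -/

theorem mem_closure_apply_ne_zero_det_eq_zero {n K : Type*} [Fintype n] [DecidableEq n]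
    [NontriviallyNormedField K] {A : Matrix n n K} (hA : A.det = 0) {i : n} (hi : A i ≠ 0) (k : n) :
    A ∈ closure {B : Matrix n n K | B i k ≠ 0 ∧ B.det = 0} := by
  by_cases hk : A i k = 0
  · obtain ⟨j, hj⟩ := Function.ne_iff.1 hi
    have hkj : k ≠ j := fun h => hj (h ▸ hk)
    let B (t : K) : Matrix n n K := A.updateCol k fun x => A x k + t • A x j
    have hB : Continuous B := continuous_const.matrix_updateCol k (by fun_prop)
    have hB0 : B 0 = A := by simp [B]
    refine hB0 ▸ map_mem_closure hB (dense_compl_singleton (0 : K) 0) fun t ht => ⟨?_, ?_⟩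
    · simpa [B, hk] using ⟨ht, hj⟩
    · exact (Matrix.det_updateCol_add_smul_self A hkj t).trans hA
  · exact subset_closure ⟨hk, hA⟩

theorem det_scaleJet (l : Fin 3 → ℂ) (z : Jet) :
    (Matrix.of (scaleJet l z)).det = l 0 ^ 3 * (Matrix.of z).det := by
  simp [Matrix.det_fin_three, scaleJet]
  ring

theorem logJet_smul_expJet {r : ℂ} (hr : r ≠ 0) (η : Fin 2 → ℂ) : logJet (r • expJet η) = η := by
  funext k
  fin_cases k <;> simp [logJet, expJet] <;> field_simp
  ring

section ExceptionalSet

variable {d : Fin 2 → ℕ}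

theorem mem_coneY_iff {q : AmbY d} : q ∈ coneY d ↔
    ¬ (q.1 0 = 0 ∧ q.2.1 = 0) ∧ (∀ c, q.2.2.2.1 c ≠ 0) ∧ (∀ c, q.2.2.2.2 c ≠ 0) ∧
      ∀ c, sectionJet d c (piAmb d q) =
        -(q.2.2.2.2 c * q.2.1 c ^ d c) • expJet ((d c : ℂ) • q.2.2.1 c) := by
  refine and_congr_right' (and_congr_right' (and_congr_right' (forall_congr' fun c => ?_)))
  simp [funext_iff, Fin.forall_fin_succ, expJet, sectionJet, piAmb, polyJet_apply_zero,
    polyJet_apply_one, polyJet_apply_two, jetVal, jetDer, jetDer2, eq_neg_iff_add_eq_zero, add_comm]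

theorem piAmb_actY (l : Fin 3 → ℂ) (μ : Fin 2 → ℂ) (q : AmbY d) :
    piAmb d (actY d l μ q) = act d l μ (piAmb d q) := by
  simp [piAmb, actY, act]

theorem actY_mem_coneY {l : Fin 3 → ℂ} (hl : l 0 ≠ 0) {μ : Fin 2 → ℂ} (hμ : ∀ c, μ c ≠ 0)
    {q : AmbY d} (hq : q ∈ coneY d) : actY d l μ q ∈ coneY d := by
  obtain ⟨h0, ha, hA, hs⟩ := mem_coneY_iff.1 hq
  refine mem_coneY_iff.2 ⟨?_, fun c => smul_ne_zero (hμ c) (ha c),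
    fun c => mul_ne_zero (hμ c) (hA c), fun c => ?_⟩
  · simpa [actY, scaleJet, hl] using h0
  · rw [piAmb_actY, sectionJet_act hl, hs c, mulJet_smul, ← expJet_add, smul_smul, ← smul_add,
      add_comm (logJet l)]
    simp only [actY, Pi.smul_apply, Pi.mul_apply, smul_eq_mul, mul_pow]
    congr 1
    ring

/-- The lift to `𝒴` of a logarithmic jet outside `𝒳`, normalized by `Z_{3+c} = 1`. -/
def liftY (p : Amb d) : AmbY d :=
  (p.1, 1, fun c => (d c : ℂ)⁻¹ • logJet (sectionJet d c p), p.2.1, fun c => -sectionJet d c p 0)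

theorem smul_liftY_logDeriv (hd : ∀ c, 1 ≤ d c) (p : Amb d) (c : Fin 2) :
    (d c : ℂ) • (liftY p).2.2.1 c = logJet (sectionJet d c p) :=
  smul_inv_smul₀ (Nat.cast_ne_zero.2 (Nat.one_le_iff_ne_zero.1 (hd c))) _

theorem liftY_mem_coneY (hd : ∀ c, 1 ≤ d c) {p : Amb d} (hs : ∀ c, sectionJet d c p 0 ≠ 0) :
    liftY p ∈ coneY d := by
  refine mem_coneY_iff.2 ⟨?_, fun c ha => hs c ?_, fun c => neg_ne_zero.2 (hs c), fun c => ?_⟩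
  · rintro ⟨-, h⟩
    exact one_ne_zero h
  · replace ha : p.2.1 c = 0 := ha
    rw [sectionJet, ha, form_zero, map_zero, Pi.zero_apply]
  · rw [smul_liftY_logDeriv hd]
    simpa [liftY, sectionJet, piAmb] using (smul_expJet_logJet (hs c)).symm

theorem piAmb_liftY (hd : ∀ c, 1 ≤ d c) {p : Amb d} (hp : p ∈ cone d)
    (hs : ∀ c, sectionJet d c p 0 ≠ 0) : piAmb d (liftY p) = p := by
  refine Prod.ext rfl (Prod.ext rfl (funext fun c => ?_))
  calc (d c : ℂ) • (liftY p).2.2.1 c = logJet (sectionJet d c p) := smul_liftY_logDeriv hd p c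
    _ = p.2.2 c := by rw [sectionJet_eq hp, logJet_smul_expJet (hs c)]

theorem continuousAt_liftY {p : Amb d} (hs : ∀ c, sectionJet d c p 0 ≠ 0) :
    ContinuousAt (liftY : Amb d → AmbY d) p := by
  have hc (c : Fin 2) : ContinuousAt (sectionJet d c) p :=
    (isPolyMap_sectionJet (d := d)).differentiable.continuous.continuousAt
  have hlog (c : Fin 2) : ContinuousAt (fun p : Amb d => logJet (sectionJet d c p)) p :=
    (differentiableAt_logJet (hs c)).continuousAt.comp (hc c)
  refine continuousAt_fst.prodMk (continuousAt_const.prodMk (ContinuousAt.prodMk ?_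
    (ContinuousAt.prodMk (by fun_prop) ?_)))
  · exact continuousAt_pi.2 fun c => (hlog c).fun_const_smul _
  · exact continuousAt_pi.2 fun c => ((continuousAt_pi.1 (hc c)) 0).neg

theorem mk_mem_sigmaZero (q : coneY d) (h0 : q.1.1 0 0 ≠ 0) (hdet : (Matrix.of q.1.1).det = 0) :
    Quotient.mk (jetSetoidY d) q ∈ sigmaZero d := by
  set l := invJet fun k => q.1.1 k 0
  have hl0 : l 0 ≠ 0 := invJet_ne _ h0
  have hμ (c : Fin 2) : (1 : Fin 2 → ℂ) c ≠ 0 := one_ne_zero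
  have hz : (fun k => scaleJet l q.1.1 k 0) = oneJet :=
    (act_apply_chart l 1 (piAmb d q) 0).trans (invJet_mul _ h0)
  have hz0 : scaleJet l q.1.1 0 0 = 1 := congrFun hz 0
  have hz1 : scaleJet l q.1.1 1 0 = 0 := congrFun hz 1
  have hz2 : scaleJet l q.1.1 2 0 = 0 := congrFun hz 2
  refine ⟨⟨actY d l 1 q, actY_mem_coneY hl0 hμ q.2⟩, Quotient.sound ⟨l, hl0, 1, hμ, rfl⟩,
    hz0, hz1, hz2, ?_⟩
  have hscaled : (Matrix.of (scaleJet l q.1.1)).det = 0 := by rw [det_scaleJet, hdet, mul_zero]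
  rw [Matrix.det_fin_three] at hscaled
  simp only [Matrix.of_apply, hz0, hz1, hz2] at hscaled
  simp only [actY]
  linear_combination hscaled

theorem mk_liftY_mem_sigma (hd : ∀ c, 1 ≤ d c) {p : Amb d} (hz : p.1 0 ≠ 0)
    (hs : ∀ c, sectionJet d c p 0 ≠ 0) (hdet : (Matrix.of p.1).det = 0) :
    Quotient.mk (jetSetoidY d) ⟨liftY p, liftY_mem_coneY hd hs⟩ ∈ sigma d := by
  let offDivisor : Set (Amb d) := {q | ∀ c, sectionJet d c q 0 ≠ 0}
  have hopen : IsOpen offDivisor := by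
    simp only [offDivisor, Set.ofPred_forall]
    have hcont (c : Fin 2) : Continuous (sectionJet d c) :=
      (isPolyMap_sectionJet (d := d)).differentiable.continuous
    exact isOpen_iInter_of_finite fun c =>
      isOpen_ne_fun ((continuous_apply 0).comp (hcont c)) continuous_const
  let degenerate : Set (Amb d) := {q | q.1 0 0 ≠ 0 ∧ (Matrix.of q.1).det = 0}
  have hp : p ∈ closure degenerate :=
    map_mem_closure (f := fun z : Matrix (Fin 3) (Fin 3) ℂ => ((z, p.2) : Amb d)) (by fun_prop)
      (mem_closure_apply_ne_zero_det_eq_zero hdet hz 0) fun z hz => hz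
  have hp' : (⟨p, hs⟩ : offDivisor) ∈ closure (Subtype.val ⁻¹' degenerate) := by
    rwa [← hopen.isOpenMap_subtype_val.preimage_closure_eq_closure_preimage
      continuous_subtype_val]
  let lift (q : offDivisor) : coneY d := ⟨liftY q, liftY_mem_coneY hd q.2⟩
  have hlift : Continuous lift :=
    (continuous_iff_continuousAt.2 fun q =>
      (continuousAt_liftY q.2).comp continuous_subtype_val.continuousAt).subtype_mk _
  have hmk : Continuous (Quotient.mk (jetSetoidY d)) := continuous_quotient_mk'
  exact map_mem_closure (f := Quotient.mk _ ∘ lift) (hmk.comp hlift) hp' fun q hq =>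
    mk_mem_sigmaZero (lift q) hq.1 hq.2

theorem mk_mem_piTwo_image_sigma (hd : ∀ c, 1 ≤ d c) (p : cone d)
    (hs : ∀ c, sectionJet d c p 0 ≠ 0) (hdet : (Matrix.of p.1.1).det = 0) :
    Quotient.mk (jetSetoid d) p ∈ piTwo d hd '' sigma d :=
  ⟨_, mk_liftY_mem_sigma hd p.2.1 hs hdet,
    congrArg (Quotient.mk _) (Subtype.ext (piAmb_liftY hd p.2 hs))⟩

theorem mk_mem_pTwo_preimage_universalFamily (p : cone d) {c : Fin 2}
    (hs : sectionJet d c p 0 = 0) :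
    Quotient.mk (jetSetoid d) p ∈ pTwo d ⁻¹' universalFamily d := by
  have hc : pTwo d (Quotient.mk (jetSetoid d) p) ∈ universalCurve d c :=
    ⟨p.1.1 0, p.2.1, p.1.2.1 c, p.2.2.1 c, rfl, rfl, hs⟩
  fin_cases c
  exacts [Or.inl hc, Or.inr hc]

end ExceptionalSet

end LogJets

end

theorem mainTheorem5_general (d : Fin 2 → ℕ) (hd : ∀ c, 1 ≤ d c) {e : ℕ} (he : 4 ≤ e)
    (m : Fin 2 → ℕ) (x : LogJets.LogJetSpace d)
    (hx : x ∉
      LogJets.piTwo d hd '' LogJets.sigma d ∪ LogJets.pTwo d ⁻¹' LogJets.universalFamily d) :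
    LogJets.GeneratedAt d e m x := by
  refine LogJets.generatedAt_of_coneTangent_le fun χ p hp hpx => ?_
  subst hpx
  have hs (c : Fin 2) : LogJets.sectionJet d c p 0 ≠ 0 := fun h =>
    hx (Or.inr (LogJets.mk_mem_pTwo_preimage_universalFamily ⟨p, hp.1⟩ h))
  have hdet : (Matrix.of p.1).det ≠ 0 := fun h =>
    hx (Or.inl (LogJets.mk_mem_piTwo_image_sigma hd ⟨p, hp.1⟩ hs h))
  exact LogJets.coneTangent_le_fieldValues hp hs hdet he m

theorem mainTheorem5 (d : Fin 2 → ℕ) (hd : ∀ c, 1 ≤ d c) :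
    ∃ m : Fin 2 → ℕ, ∀ x : LogJets.LogJetSpace d,
      x ∉ LogJets.piTwo d hd '' LogJets.sigma d ∪ LogJets.pTwo d ⁻¹' LogJets.universalFamily d →
        LogJets.GeneratedAt d 7 m x :=
  ⟨0, mainTheorem5_general d hd (by norm_num) 0⟩
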